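/- Let $\mu\ge 1$, $d\ge 1$, $\Gamma=\mathbb Z^\mu$, and let $\mathcal A=\bigotimes_{x\in\Gamma}M_d(\mathbb C)$ be the quasi-local $C^*$-algebra of a quantum spin system on $\Gamma$, with local algebras $\mathcal A_\Lambda$ (for finite $\Lambda\subset\Gamma$), space translations $\tau_x$ ($x\in\Gamma$), and tracial state $\mathrm{tr}$. Let $\{h_x\}_{x\in\Gamma}$ be self-adjoint elements of $\mathcal A$ with uniformly bounded norms such that, for some $R$ and all $x$, $h_x$ belongs to the algebra of the box $\{y:\max_k|y_k-x_k|\le R\}$. For finite $\Lambda\subset\Gamma$ and $\beta\ge 0$, $t\in\mathbb R$ put $$H_\Lambda=\sum_{x\in\Lambda}h_x,\qquad \alpha_{\Lambda,t}(A)=e^{itH_\Lambda}Ae^{-itH_\Lambda},\qquad \rho^{\beta}_{\Lambda}(A)=\frac{\mathrm{tr}(e^{-\beta H_\Lambda}A)}{\mathrm{tr}(e^{-\beta H_\Lambda})},\qquad m_\Lambda(A)=\frac1{|\Lambda|}\sum_{x\in\Lambda}\tau_x(A)\quad(A\in\mathcal A).$$ Let $(\alpha_t)_{t\in\mathbb R}$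 be a strongly continuous one-parameter group of $*$-automorphisms of $\mathcal A$ that commutes with all $\tau_x$ and is approximately inner: $\alpha_{\Lambda,t}(A)\to\alpha_t(A)$ in norm as $\Lambda\uparrow\Gamma$, for all $A\in\mathcal A$ and $t\in\mathbb R$. Let $A_0,B_0$ be local elements of $\mathcal A$, and write $\widehat A_\Lambda=m_\Lambda(A_0)$, $\widehat B_\Lambda=m_\Lambda(B_0)$. Let $\varphi$ be a limiting Gibbs state, i.e. a state on $\mathcal A$ with $\rho^\beta_{\Lambda_1}(A)\to\varphi(A)$ for all $A\in\mathcal A$ along some net of finite sets $\Lambda_1\uparrow\Gamma$ (a net that eventually contains every finite subset of $\Gamma$). Assume that $\varphi$ is homogeneous, i.e. invariant under $\tau_x$ for all $x$ in some subgroup of finite index of $\Gamma$. Let $(\mathcal H_\varphi,\pi_\varphi,\Omega_\varphi)$ be the GNS triple of $\varphi$. A density of $A\in\mathcal A$ is an accumulation point, in the weak operator topology, of $\pi_\varphi(m_\Lambda(A))$ along finite sets $\Lambda\uparrow\Gamma$ in the sense of van Hove, which means that $\Lambda$ eventually contains every finite subset of $\Gamma$ and that for each $m$ the fraction of those $x\in\Lambda$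 for which the box of radius $m$ around $x$ is not contained in $\Lambda$ tends to $0$. Then, for every $t\in\mathbb R$, the temporal correlation $$f^{\varphi}_{A_0,B_0}(t)=\bigl\langle\Omega_\varphi,\ \widehat A^\varphi_\infty(t)\,\widehat B^\varphi_\infty\,\Omega_\varphi\bigr\rangle,$$ where $\widehat A^\varphi_\infty(t)$ is a density of $\alpha_t(A_0)$ and $\widehat B^\varphi_\infty$ is a density of $B_0$, is well defined (such densities exist, and the value does not depend on their choice), and $$\lim_{\Lambda_2\uparrow\Gamma}\ \lim_{\Lambda_1\uparrow\Gamma}\ \rho^{\beta}_{\Lambda_1}\bigl(\alpha_{\Lambda_2,t}(\widehat A_{\Lambda_2})\,\widehat B_{\Lambda_2}\bigr)=f^{\varphi}_{A_0,B_0}(t),$$ where both limits exist, the inner limit is taken along the given net $\Lambda_1\uparrow\Gamma$, and the outer limit is taken in the sense of van Hove. -/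

import Mathlib

open Filter Topology MeasureTheory

/-! ### The quantum spin algebra on the lattice `ℤ^μ` -/

/-- The lattice `ℤ^μ`. -/
abbrev Site (μ : ℕ) : Type := Fin μ → ℤ

/-- Classical configurations: a basis label in `Fin d` at every site. -/
abbrev Config (d μ : ℕ) : Type := Site μ → Fin d

/-- The Hilbert space `ℓ²` over all configurations, on which the spin algebra is represented
faithfully. Its standard basis vectors are written `δ_σ` below. -/
abbrev SpinSpace (d μ : ℕ) : Type := lp (fun _ : Config d μ => ℂ) 2

section PartialPullback

variable {I : Type}

/-- `f ↦ 1_s · (f ∘ e)` maps `ℓ²` to `ℓ²` and does not increase the norm,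
if `e` is injective on `s`. -/
theorem partialPullback_aux (s : Set I) (e : I → I) (he : Set.InjOn e s)
    (f : lp (fun _ : I => ℂ) 2) :
    ∃ h : Memℓp (E := fun _ : I => ℂ) (s.indicator (fun i => f (e i))) 2,
      ‖(⟨_, h⟩ : lp (fun _ : I => ℂ) 2)‖ ≤ ‖f‖ := by
  classical
  have h2 : (0 : ℝ) < (2 : ENNReal).toReal := by norm_num
  have hf : Summable fun i => ‖f i‖ ^ (2 : ENNReal).toReal :=
    (memℓp_gen_iff h2).1 (lp.memℓp f)
  have hsub : Summable fun i : s => ‖f (e i)‖ ^ (2 : ENNReal).toReal :=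
    hf.comp_injective (i := fun i : s => e i) he.injective
  have heq : (fun i => ‖s.indicator (fun i => f (e i)) i‖ ^ (2 : ENNReal).toReal)
      = s.indicator (fun i => ‖f (e i)‖ ^ (2 : ENNReal).toReal) := by
    funext i
    by_cases hi : i ∈ s
    · simp [hi]
    · simp [hi]
  have hsum : Summable fun i => ‖s.indicator (fun i => f (e i)) i‖ ^ (2 : ENNReal).toReal := by
    rw [heq]
    exact summable_subtype_iff_indicator.1 hsub
  refine ⟨memℓp_gen hsum, ?_⟩
  have key : ∑' i, ‖s.indicator (fun i => f (e i)) i‖ ^ (2 : ENNReal).toReal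
      ≤ ∑' i, ‖f i‖ ^ (2 : ENNReal).toReal := by
    rw [heq, ← tsum_subtype]
    exact tsum_comp_le_tsum_of_inj hf (fun i => by positivity)
      (i := fun i : s => e i) he.injective
  rw [lp.norm_eq_tsum_rpow h2, lp.norm_eq_tsum_rpow h2]
  exact Real.rpow_le_rpow (tsum_nonneg fun i => by positivity) key (by positivity)

/-- The operator `f ↦ 1_s · (f ∘ e)` on `ℓ²`, for `e` injective on `s`. -/
noncomputable def partialPullback (s : Set I) (e : I → I) (he : Set.InjOn e s) :
    lp (fun _ : I => ℂ) 2 →L[ℂ] lp (fun _ : I => ℂ) 2 :=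
  LinearMap.mkContinuous
    { toFun := fun f => ⟨_, (partialPullback_aux s e he f).choose⟩
      map_add' := fun f g => by
        ext i
        change s.indicator (fun i => f (e i) + g (e i)) i =
          s.indicator (fun i => f (e i)) i + s.indicator (fun i => g (e i)) i
        by_cases hi : i ∈ s <;> simp [hi]
      map_smul' := fun c f => by
        ext i
        change s.indicator (fun i => c • f (e i)) i = c • s.indicator (fun i => f (e i)) i
        by_cases hi : i ∈ s <;> simp [hi] } 1
    (fun f => by
      rw [one_mul]
      exact (partialPullback_aux s e he f).choose_spec)

theorem partialPullback_apply (s : Set I) (e : I → I) (he : Set.InjOn e s)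
    (f : lp (fun _ : I => ℂ) 2) (i : I) :
    partialPullback s e he f i = s.indicator (fun i => f (e i)) i := rfl

theorem partialPullback_norm_le (s : Set I) (e : I → I) (he : Set.InjOn e s)
    (f : lp (fun _ : I => ℂ) 2) : ‖partialPullback s e he f‖ ≤ ‖f‖ :=
  (partialPullback_aux s e he f).choose_spec

/-- The unitary `f ↦ f ∘ e` on `ℓ²`, for a permutation `e` of the index set. -/
noncomputable def permUnitary (e : Equiv.Perm I) :
    lp (fun _ : I => ℂ) 2 ≃ₗᵢ[ℂ] lp (fun _ : I => ℂ) 2 where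
  toFun := partialPullback Set.univ e e.injective.injOn
  map_add' := map_add _
  map_smul' := map_smul _
  invFun := partialPullback Set.univ e.symm e.symm.injective.injOn
  left_inv f := by
    ext i
    simp [partialPullback_apply]
  right_inv f := by
    ext i
    simp [partialPullback_apply]
  norm_map' f := by
    refine le_antisymm
      (partialPullback_norm_le Set.univ e e.injective.injOn f) ?_
    have h : partialPullback Set.univ e.symm e.symm.injective.injOn
        (partialPullback Set.univ e e.injective.injOn f) = f := by
      ext i
      simp [partialPullback_apply]
    have h' := partialPullback_norm_le Set.univ e.symm e.symm.injective.injOn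
      (partialPullback Set.univ e e.injective.injOn f)
    rw [h] at h'
    exact h'

theorem permUnitary_apply (e : Equiv.Perm I) (f : lp (fun _ : I => ℂ) 2) (i : I) :
    permUnitary e f i = f (e i) := by
  change partialPullback Set.univ e e.injective.injOn f i = _
  simp [partialPullback_apply]

theorem permUnitary_symm_apply (e : Equiv.Perm I) (f : lp (fun _ : I => ℂ) 2) (i : I) :
    (permUnitary e).symm f i = f (e.symm i) := by
  change partialPullback Set.univ e.symm e.symm.injective.injOn f i = _
  simp [partialPullback_apply]

end PartialPullback

variable {d μ : ℕ}

theorem updateInjOn (x : Site μ) (i j : Fin d) :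
    Set.InjOn (fun σ : Config d μ => Function.update σ x j) {σ | σ x = i} := by
  intro σ hσ σ' hσ' h
  funext y
  by_cases hy : y = x
  · subst hy
    rw [Set.mem_ofPred_eq] at hσ hσ'
    rw [hσ, hσ']
  · simpa [Function.update_of_ne hy] using congrFun h y

/-- The matrix unit `e_{ij}` of `M_d(ℂ)` acting on the tensor factor at the site `x`:
it maps `δ_σ` to `δ_{σ'}`, where `σ'` is `σ` with the label at `x` changed to `i`, if `σ x = j`,
and to `0` otherwise. -/
noncomputable def matrixUnit (x : Site μ) (i j : Fin d) :
    SpinSpace d μ →L[ℂ] SpinSpace d μ :=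
  partialPullback {σ : Config d μ | σ x = i} (fun σ => Function.update σ x j) (updateInjOn x i j)

/-- The algebra `𝒜_Λ` generated by the one-site matrix algebras `M_d(ℂ)` at the sites of `Λ`. -/
noncomputable def localAlgebra (d : ℕ) (Λ : Set (Site μ)) :
    StarSubalgebra ℂ (SpinSpace d μ →L[ℂ] SpinSpace d μ) :=
  StarAlgebra.adjoin ℂ {T | ∃ x ∈ Λ, ∃ i j : Fin d, T = matrixUnit x i j}

/-- The norm closure of the algebra generated by all one-site algebras. -/
noncomputable def quasiLocalAlgebra (d μ : ℕ) :
    StarSubalgebra ℂ (SpinSpace d μ →L[ℂ] SpinSpace d μ) :=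
  (localAlgebra d (Set.univ : Set (Site μ))).topologicalClosure

instance quasiLocalAlgebra_isClosed :
    IsClosed (quasiLocalAlgebra d μ : Set (SpinSpace d μ →L[ℂ] SpinSpace d μ)) :=
  StarSubalgebra.isClosed_topologicalClosure _

/-- The quasi-local C*-algebra `𝒜 = ⨂_{x ∈ ℤ^μ} M_d(ℂ)` of the quantum spin system. -/
abbrev SpinAlgebra (d μ : ℕ) : Type := quasiLocalAlgebra d μ

noncomputable instance : CStarAlgebra (SpinAlgebra d μ) :=
  StarSubalgebra.cstarAlgebra (quasiLocalAlgebra d μ)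

/-- `A` belongs to `𝒜_loc`, the union of the `𝒜_Λ` over finite `Λ`. -/
def IsLocal (A : SpinAlgebra d μ) : Prop :=
  ∃ Λ : Finset (Site μ), (A : SpinSpace d μ →L[ℂ] SpinSpace d μ) ∈ localAlgebra d (Λ : Set (Site μ))

/-- The shift `σ ↦ σ(· + x)` of configurations. -/
def shiftConfig (x : Site μ) : Equiv.Perm (Config d μ) where
  toFun σ := fun y => σ (y + x)
  invFun σ := fun y => σ (y - x)
  left_inv σ := by
    funext y
    simp
  right_inv σ := by
    funext y
    simp

/-- Conjugation by the unitary that moves the label at each site `y` to the site `y + x`. -/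
noncomputable def shiftConj (x : Site μ) :
    (SpinSpace d μ →L[ℂ] SpinSpace d μ) ≃⋆ₐ[ℂ] (SpinSpace d μ →L[ℂ] SpinSpace d μ) :=
  (permUnitary (shiftConfig (d := d) x)).conjStarAlgEquiv

theorem shiftConj_matrixUnit (x y : Site μ) (i j : Fin d) :
    shiftConj x (matrixUnit y i j) = matrixUnit (y + x) i j := by
  ext f σ
  change permUnitary (shiftConfig x) (matrixUnit y i j ((permUnitary (shiftConfig x)).symm f)) σ = _
  rw [permUnitary_apply]
  simp only [matrixUnit, partialPullback_apply]
  by_cases h : σ (y + x) = i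
  · rw [Set.indicator_of_mem (show shiftConfig x σ ∈ {σ : Config d μ | σ y = i} from h),
      Set.indicator_of_mem (show σ ∈ {σ : Config d μ | σ (y + x) = i} from h),
      permUnitary_symm_apply]
    refine congrArg (fun σ' => f σ') ?_
    funext z
    by_cases hz : z = y + x
    · subst hz
      simp [shiftConfig]
    · have hz' : z - x ≠ y := fun h' => hz (by rw [← h']; simp)
      simp [shiftConfig, Function.update_of_ne hz, Function.update_of_ne hz']
  · rw [Set.indicator_of_notMem (show shiftConfig x σ ∉ {σ : Config d μ | σ y = i} from h),
      Set.indicator_of_notMem (show σ ∉ {σ : Config d μ | σ (y + x) = i} from h)]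

theorem shiftConj_mem (x : Site μ) {T : SpinSpace d μ →L[ℂ] SpinSpace d μ}
    (hT : T ∈ quasiLocalAlgebra d μ) : shiftConj x T ∈ quasiLocalAlgebra d μ := by
  have hcont : Continuous (shiftConj (d := d) x) :=
    (StarAlgEquiv.isometry (shiftConj (d := d) x)).continuous
  have hle : localAlgebra d (Set.univ : Set (Site μ)) ≤
      (quasiLocalAlgebra d μ).comap
        (shiftConj (d := d) x : (SpinSpace d μ →L[ℂ] SpinSpace d μ) →⋆ₐ[ℂ]
          (SpinSpace d μ →L[ℂ] SpinSpace d μ)) := by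
    refine StarAlgebra.adjoin_le ?_
    rintro _ ⟨y, -, i, j, rfl⟩
    change shiftConj x (matrixUnit y i j) ∈ quasiLocalAlgebra d μ
    rw [shiftConj_matrixUnit]
    exact StarSubalgebra.le_topologicalClosure _
      (StarAlgebra.subset_adjoin ℂ _ ⟨y + x, Set.mem_univ _, i, j, rfl⟩)
  exact StarSubalgebra.topologicalClosure_minimal hle
    (quasiLocalAlgebra_isClosed.preimage hcont) hT

/-- The space translation `τ_x` of `𝒜`, which maps `𝒜_Λ` to `𝒜_{Λ + x}`. -/
noncomputable def translation (x : Site μ) : SpinAlgebra d μ →⋆ₐ[ℂ] SpinAlgebra d μ :=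
  StarAlgHom.codRestrict
    (((shiftConj (d := d) x : (SpinSpace d μ →L[ℂ] SpinSpace d μ) →⋆ₐ[ℂ]
      (SpinSpace d μ →L[ℂ] SpinSpace d μ))).comp (quasiLocalAlgebra d μ).subtype)
    (quasiLocalAlgebra d μ) (fun A => shiftConj_mem x A.2)

/-! ### Local Hamiltonians, local dynamics, local Gibbs states -/

/-- The box of the sites at distance at most `R` from `x` in the maximum norm. -/
def box (x : Site μ) (R : ℕ) : Set (Site μ) := {y | ∀ k, |y k - x k| ≤ (R : ℤ)}

/-- `h` is a family of self-adjoint elements `h_x`, each localized around `x`, with uniformly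
bounded range and uniformly bounded norm. -/
structure IsFiniteRange (h : Site μ → SpinAlgebra d μ) : Prop where
  selfAdjoint : ∀ x, IsSelfAdjoint (h x)
  range : ∃ R : ℕ, ∀ x,
    (h x : SpinSpace d μ →L[ℂ] SpinSpace d μ) ∈ localAlgebra d (box x R)
  bounded : ∃ N : ℝ, ∀ x, ‖h x‖ ≤ N

/-- `H_Λ = ∑_{x ∈ Λ} h_x`. -/
noncomputable def localHamiltonian (h : Site μ → SpinAlgebra d μ) (Λ : Finset (Site μ)) :
    SpinAlgebra d μ := ∑ x ∈ Λ, h x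

/-- `α_{Λ,t}(A) = e^{itH_Λ} A e^{-itH_Λ}`. -/
noncomputable def localEvolution (h : Site μ → SpinAlgebra d μ) (Λ : Finset (Site μ)) (t : ℝ)
    (A : SpinAlgebra d μ) : SpinAlgebra d μ :=
  NormedSpace.exp ((Complex.I * (t : ℂ)) • localHamiltonian h Λ) * A *
    NormedSpace.exp ((-(Complex.I * (t : ℂ))) • localHamiltonian h Λ)

/-- The uniform probability measure on `Fin d` at every site, independently. -/
noncomputable def uniformConfigMeasure (d μ : ℕ) : Measure (Config d μ) :=
  Measure.infinitePi (fun _ : Site μ => ProbabilityTheory.uniformOn (Set.univ : Set (Fin d)))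

/-- The tracial state of `𝒜`: the mean of the diagonal entries `⟨δ_σ, A δ_σ⟩`
over all configurations. For `A ∈ 𝒜_Λ` with `Λ` finite, an entry depends on the labels in `Λ` only,
and the mean is the normalized trace `d^{-|Λ|} Tr A`. -/
noncomputable def tracialState (A : SpinAlgebra d μ) : ℂ :=
  open scoped Classical in
  ∫ σ, inner ℂ (lp.single 2 σ (1 : ℂ) : SpinSpace d μ)
    ((A : SpinSpace d μ →L[ℂ] SpinSpace d μ) (lp.single 2 σ (1 : ℂ)))
    ∂(uniformConfigMeasure d μ)

/-- The local Gibbs state `A ↦ tr(e^{-βH_Λ} A) / tr(e^{-βH_Λ})`, on the whole of `𝒜`. -/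
noncomputable def gibbsState (h : Site μ → SpinAlgebra d μ) (β : ℝ) (Λ : Finset (Site μ))
    (A : SpinAlgebra d μ) : ℂ :=
  tracialState (NormedSpace.exp ((-(β : ℂ)) • localHamiltonian h Λ) * A) /
    tracialState (NormedSpace.exp ((-(β : ℂ)) • localHamiltonian h Λ))

/-! ### States and infinite-volume dynamics -/

open scoped ComplexOrder in
/-- A normalized positive linear functional. -/
def IsState (φ : SpinAlgebra d μ →ₗ[ℂ] ℂ) : Prop :=
  φ 1 = 1 ∧ ∀ A, 0 ≤ φ (star A * A)

/-- Invariance under the translations in a subgroup of finite index of `ℤ^μ`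
(translation invariance if the subgroup is `ℤ^μ` itself, spatial periodicity in general). -/
def IsHomogeneous (φ : SpinAlgebra d μ →ₗ[ℂ] ℂ) : Prop :=
  ∃ Δ : AddSubgroup (Site μ), Δ.FiniteIndex ∧ ∀ x ∈ Δ, ∀ A, φ (translation x A) = φ A

/-- A strongly continuous one-parameter group of *-automorphisms. -/
structure IsCStarDynamics (α : ℝ → (SpinAlgebra d μ ≃⋆ₐ[ℂ] SpinAlgebra d μ)) : Prop where
  zero : ∀ A, α 0 A = A
  add : ∀ s t A, α (s + t) A = α s (α t A)
  continuous : ∀ A, Tendsto (fun t => α t A) (𝓝 0) (𝓝 A)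

/-- The dynamics commutes with all space translations. -/
def IsTranslationInvariant (α : ℝ → (SpinAlgebra d μ ≃⋆ₐ[ℂ] SpinAlgebra d μ)) : Prop :=
  ∀ t x A, α t (translation x A) = translation x (α t A)

/-- `α_t(A)` is the norm limit of `α_{Λ,t}(A)` as `Λ ↑ ℤ^μ`. -/
def IsApproximatelyInner (h : Site μ → SpinAlgebra d μ)
    (α : ℝ → (SpinAlgebra d μ ≃⋆ₐ[ℂ] SpinAlgebra d μ)) : Prop :=
  ∀ t A, Tendsto (fun Λ => localEvolution h Λ t A) atTop (𝓝 (α t A))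

/-! ### Averages, van Hove limits, macroscopic observables -/

/-- `m_Λ(A) = |Λ|⁻¹ ∑_{x ∈ Λ} τ_x(A)`. -/
noncomputable def spaceAverage (Λ : Finset (Site μ)) (A : SpinAlgebra d μ) : SpinAlgebra d μ :=
  ((Λ.card : ℂ)⁻¹) • ∑ x ∈ Λ, translation x A

/-- The fraction of the sites of `Λ` whose surrounding box of radius `m` leaves `Λ`. -/
noncomputable def boundaryFraction (m : ℕ) (Λ : Finset (Site μ)) : ℝ :=
  (Set.ncard {x : Site μ | x ∈ Λ ∧ ¬ box x m ⊆ (Λ : Set (Site μ))} : ℝ) / (Λ.card : ℝ)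

/-- The van Hove limit: `Λ` eventually contains every finite set, and its boundary fractions
tend to zero. A net of finite sets tends to infinity in the sense of van Hove if and only if
it tends to this filter. -/
noncomputable def vanHove (μ : ℕ) : Filter (Finset (Site μ)) :=
  atTop ⊓ ⨅ m : ℕ, comap (boundaryFraction m) (𝓝 0)

section GNS

variable {E : Type*} [NormedAddCommGroup E] [InnerProductSpace ℂ E] [CompleteSpace E]

/-- `(E, π, Ω)` is the GNS triple of `φ`, which is unique up to unitary equivalence:
`Ω` is a cyclic vector and `φ(A) = ⟨Ω, π(A) Ω⟩`. -/
structure IsGNSTriple (φ : SpinAlgebra d μ →ₗ[ℂ] ℂ) (π : SpinAlgebra d μ →⋆ₐ[ℂ] (E →L[ℂ] E))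
    (Ω : E) : Prop where
  vector_state : ∀ A, φ A = inner ℂ Ω (π A Ω)
  cyclic : Dense (Set.range fun A => π A Ω)

/-- `a` is a macroscopic observable (density) of `A`: an accumulation point, in the weak operator
topology, of the averages `π(m_Λ(A))` as `Λ ↑ ℤ^μ`. -/
def IsDensity (π : SpinAlgebra d μ →⋆ₐ[ℂ] (E →L[ℂ] E)) (A : SpinAlgebra d μ) (a : E →L[ℂ] E) :
    Prop :=
  MapClusterPt (ContinuousLinearMapWOT.ofCLM a : E →WOT[ℂ] E) (vanHove μ)
    (fun Λ => ContinuousLinearMapWOT.ofCLM (π (spaceAverage Λ A)))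

/-- The possible values of the temporal correlation function `⟨Ω, Â_∞(t) B̂_∞ Ω⟩`, where `Â_∞(t)`
is a density of `α_t(A)` and `B̂_∞` is a density of `B`. -/
def temporalCorrelations (π : SpinAlgebra d μ →⋆ₐ[ℂ] (E →L[ℂ] E)) (Ω : E)
    (α : ℝ → (SpinAlgebra d μ ≃⋆ₐ[ℂ] SpinAlgebra d μ)) (A B : SpinAlgebra d μ) (t : ℝ) : Set ℂ :=
  {z | ∃ a b : E →L[ℂ] E, IsDensity π (α t A) a ∧ IsDensity π B b ∧ z = inner ℂ Ω (a (b Ω))}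

end GNS

/-! ### Locality -/

/-! For fixed `Λ₂` the observable is a fixed element of the algebra, so the inner limit is the value
of `φ` on it, by the definition of a limiting Gibbs state. The Gibbs property plays no further role;
what remains is a statement about a homogeneous state, and it rests on two facts.

First, `π (spaceAverage Λ A)` converges strongly for every `A`, so `A` has exactly one density. On
`Ω` this is a mean ergodic theorem (`cauchy_map_spaceAverage`, `cauchy_map_spaceAverage_vector`).
Averages of quasi-local elements asymptotically commute with every element
(`tendsto_commutator_spaceAverage`), which carries convergence from `Ω` to the vectors `π C Ω`;
cyclicity and the bound `‖A‖` on the averages extend it to all vectors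
(`exists_tendsto_spaceAverage`).

Second, the local evolution of the average of `A₀` differs in norm from the average of `α t A₀` by a
quantity tending to zero (`tendsto_localEvolution_spaceAverage_sub`). Sites near the boundary of `Λ`
are negligible in the van Hove limit. For the others, the evolution of `translation x A₀` has to be
close to its infinite-volume limit uniformly in `x`. Approximate innerness alone does not give this,
because `h` need not be translation covariant. The finite range and the uniform bound on `h` do: the
commutator series converges at a rate independent of `x` and `Λ` for small times, and the group law
reaches all times (`IsFiniteRange.hasUniformApproximation`).

With both facts the product of the two averages, applied to `Ω`, converges to the product of the two
densities applied to `Ω`. -/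

theorem matrixUnit_apply (x : Site μ) (i j : Fin d) (f : SpinSpace d μ) (σ : Config d μ) :
    matrixUnit x i j f σ = if σ x = i then f (Function.update σ x j) else 0 := by
  simp [matrixUnit, partialPullback_apply, Set.indicator_apply]

theorem matrixUnit_commute {x y : Site μ} (hxy : x ≠ y) (i j k l : Fin d) :
    Commute (matrixUnit x i j) (matrixUnit y k l) := by
  ext f σ
  simp only [mul_apply_eq_comp, matrixUnit_apply, Function.update_of_ne hxy,
    Function.update_of_ne hxy.symm, Function.update_comm hxy]
  split_ifs <;> rfl

open scoped Classical in
theorem matrixUnit_single (x : Site μ) (i j : Fin d) (σ : Config d μ) :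
    matrixUnit x i j (lp.single 2 σ (1 : ℂ)) =
      if σ x = j then lp.single 2 (Function.update σ x i) (1 : ℂ) else 0 := by
  ext ρ
  rw [matrixUnit_apply]
  have key : (ρ x = i ∧ Function.update ρ x j = σ) ↔
      (σ x = j ∧ ρ = Function.update σ x i) := by
    constructor
    · rintro ⟨h, rfl⟩
      simp [← h]
    · rintro ⟨h, rfl⟩
      simp [← h]
  by_cases h : σ x = j <;> by_cases h' : ρ x = i <;>
    simp only [h, h', if_true, if_false, lp.single_apply, Pi.single_apply, true_and, false_and]
      at key ⊢
  · simp only [key]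
  · simp [← key]
  · simp [key]
  · simp

theorem star_matrixUnit (x : Site μ) (i j : Fin d) :
    star (matrixUnit x i j) = matrixUnit x j i := by
  classical
  ext f σ
  have h1 : ∀ (g : SpinSpace d μ) (ρ : Config d μ),
      inner ℂ (lp.single 2 ρ (1 : ℂ) : SpinSpace d μ) g = g ρ := fun g ρ => by
    rw [lp.inner_single_left]; simp
  rw [← h1, ContinuousLinearMap.star_eq_adjoint, ContinuousLinearMap.adjoint_inner_right,
    matrixUnit_single, matrixUnit_apply]
  split_ifs
  · rw [h1]
  · simp

theorem localAlgebra_mono {S T : Set (Site μ)} (h : S ⊆ T) :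
    localAlgebra d S ≤ localAlgebra d T :=
  StarAlgebra.adjoin_mono fun _ ⟨x, hx, i, j, hT⟩ => ⟨x, h hx, i, j, hT⟩

theorem localAlgebra_le_quasiLocalAlgebra (S : Set (Site μ)) :
    localAlgebra d S ≤ quasiLocalAlgebra d μ :=
  (localAlgebra_mono (Set.subset_univ S)).trans (StarSubalgebra.le_topologicalClosure _)

/-- Matrix units at different sites commute, and a centralizer is a star subalgebra, so it suffices
to check generators. This is done twice, once for each factor; commutation with `star A` is the
adjoint of the commutation of `A` with `star B'`. -/
theorem commute_of_disjoint {S T : Set (Site μ)} (hST : Disjoint S T)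
    {A B : SpinSpace d μ →L[ℂ] SpinSpace d μ} (hA : A ∈ localAlgebra d S)
    (hB : B ∈ localAlgebra d T) : Commute A B := by
  have h1 : localAlgebra d S ≤ StarSubalgebra.centralizer ℂ
      {T' | ∃ x ∈ T, ∃ i j : Fin d, T' = matrixUnit x i j} := by
    refine StarAlgebra.adjoin_le ?_
    rintro _ ⟨x, hx, i, j, rfl⟩
    rw [SetLike.mem_coe, StarSubalgebra.mem_centralizer_iff]
    rintro _ ⟨y, hy, k, l, rfl⟩
    have hxy : y ≠ x := fun h => Set.disjoint_left.1 hST hx (h ▸ hy)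
    rw [star_matrixUnit]
    exact ⟨matrixUnit_commute hxy k l i j, matrixUnit_commute hxy l k i j⟩
  have h2 : localAlgebra d T ≤ StarSubalgebra.centralizer ℂ {A} := by
    refine StarAlgebra.adjoin_le ?_
    rintro B' hB'
    rw [SetLike.mem_coe, StarSubalgebra.mem_centralizer_iff]
    rintro _ rfl
    have h3 := (StarSubalgebra.mem_centralizer_iff ℂ).1 (h1 hA) _ hB'
    refine ⟨h3.1.symm, ?_⟩
    have := congrArg star h3.2
    simpa using this
  exact ((StarSubalgebra.mem_centralizer_iff ℂ).1 (h2 hB) A rfl).1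

/-- `A` belongs to the local algebra of `S`. -/
def IsLocalIn (S : Set (Site μ)) (A : SpinAlgebra d μ) : Prop :=
  (A : SpinSpace d μ →L[ℂ] SpinSpace d μ) ∈ localAlgebra d S

namespace IsLocalIn

variable {S T : Set (Site μ)} {A B : SpinAlgebra d μ}

theorem mono (hA : IsLocalIn S A) (h : S ⊆ T) : IsLocalIn T A := localAlgebra_mono h hA

theorem add (hA : IsLocalIn S A) (hB : IsLocalIn S B) : IsLocalIn S (A + B) := add_mem hA hB

theorem sub (hA : IsLocalIn S A) (hB : IsLocalIn S B) : IsLocalIn S (A - B) := sub_mem hA hB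

theorem mul (hA : IsLocalIn S A) (hB : IsLocalIn S B) : IsLocalIn S (A * B) := mul_mem hA hB

theorem smul (hA : IsLocalIn S A) (c : ℂ) : IsLocalIn S (c • A) :=
  (localAlgebra d S).toSubalgebra.smul_mem hA c

theorem sum {ι : Type*} {s : Finset ι} {F : ι → SpinAlgebra d μ}
    (h : ∀ i ∈ s, IsLocalIn S (F i)) : IsLocalIn S (∑ i ∈ s, F i) := by
  classical
  induction s using Finset.induction_on with
  | empty => simp [IsLocalIn]
  | insert i s hi ih =>
    rw [Finset.sum_insert hi]
    exact (h i (by simp)).add (ih fun j hj => h j (by simp [hj]))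

theorem commute (hST : Disjoint S T) (hA : IsLocalIn S A) (hB : IsLocalIn T B) :
    Commute A B :=
  Subtype.ext (commute_of_disjoint hST hA hB)

theorem translation (hA : IsLocalIn S A) (x : Site μ) :
    IsLocalIn ((· + x) '' S) (translation x A) := by
  have : localAlgebra d S ≤ (localAlgebra d ((· + x) '' S)).comap
      (shiftConj (d := d) x : (SpinSpace d μ →L[ℂ] SpinSpace d μ) →⋆ₐ[ℂ]
          (SpinSpace d μ →L[ℂ] SpinSpace d μ)) := by
    refine StarAlgebra.adjoin_le ?_
    rintro _ ⟨y, hy, i, j, rfl⟩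
    change shiftConj x (matrixUnit y i j) ∈ localAlgebra d ((· + x) '' S)
    rw [shiftConj_matrixUnit]
    exact StarAlgebra.subset_adjoin ℂ _ ⟨y + x, ⟨y, hy, rfl⟩, i, j, rfl⟩
  exact this hA

end IsLocalIn

theorem exists_finset_mem_localAlgebra {T : SpinSpace d μ →L[ℂ] SpinSpace d μ}
    (hT : T ∈ localAlgebra d (Set.univ : Set (Site μ))) :
    ∃ S : Finset (Site μ), T ∈ localAlgebra d (S : Set (Site μ)) := by
  classical
  have hl (S S' : Finset (Site μ)) : localAlgebra d (S : Set (Site μ)) ≤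
      localAlgebra d ((S ∪ S' : Finset (Site μ)) : Set (Site μ)) :=
    localAlgebra_mono (by simp)
  have hr (S S' : Finset (Site μ)) : localAlgebra d (S' : Set (Site μ)) ≤
      localAlgebra d ((S ∪ S' : Finset (Site μ)) : Set (Site μ)) :=
    localAlgebra_mono (by simp)
  refine StarAlgebra.adjoin_induction (fun T hT => ?_) (fun r => ?_) (fun A B _ _ hA hB => ?_)
    (fun A B _ _ hA hB => ?_) (fun A _ hA => ?_) hT
  · obtain ⟨x, -, i, j, rfl⟩ := hT
    exact ⟨{x}, StarAlgebra.subset_adjoin ℂ _ ⟨x, by simp, i, j, rfl⟩⟩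
  · exact ⟨∅, algebraMap_mem _ r⟩
  · obtain ⟨S, hS⟩ := hA
    obtain ⟨S', hS'⟩ := hB
    exact ⟨S ∪ S', add_mem (hl S S' hS) (hr S S' hS')⟩
  · obtain ⟨S, hS⟩ := hA
    obtain ⟨S', hS'⟩ := hB
    exact ⟨S ∪ S', mul_mem (hl S S' hS) (hr S S' hS')⟩
  · obtain ⟨S, hS⟩ := hA
    exact ⟨S, star_mem hS⟩

theorem exists_isLocal_norm_sub_le (A : SpinAlgebra d μ) {ε : ℝ} (hε : 0 < ε) :
    ∃ B : SpinAlgebra d μ, IsLocal B ∧ ‖A - B‖ ≤ ε := by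
  have hA : (A : SpinSpace d μ →L[ℂ] SpinSpace d μ) ∈
      closure (localAlgebra d (Set.univ : Set (Site μ)) :
        Set (SpinSpace d μ →L[ℂ] SpinSpace d μ)) := A.2
  obtain ⟨B, hB, hAB⟩ := Metric.mem_closure_iff.1 hA ε hε
  refine ⟨⟨B, localAlgebra_le_quasiLocalAlgebra _ hB⟩, exists_finset_mem_localAlgebra hB, ?_⟩
  rw [dist_eq_norm] at hAB
  exact hAB.le

/-! ### Translations -/

theorem translation_translation (x y : Site μ) (A : SpinAlgebra d μ) :
    translation x (translation y A) = translation (y + x) A := by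
  refine Subtype.ext ?_
  change shiftConj x (shiftConj y (A : SpinSpace d μ →L[ℂ] SpinSpace d μ)) =
    shiftConj (y + x) (A : SpinSpace d μ →L[ℂ] SpinSpace d μ)
  ext f σ
  change permUnitary (shiftConfig x) (permUnitary (shiftConfig y) ((A : SpinSpace d μ →L[ℂ] _)
    ((permUnitary (shiftConfig y)).symm ((permUnitary (shiftConfig x)).symm f)))) σ =
    permUnitary (shiftConfig (y + x)) ((A : SpinSpace d μ →L[ℂ] _)
      ((permUnitary (shiftConfig (y + x))).symm f)) σ
  have h : (permUnitary (shiftConfig y)).symm ((permUnitary (shiftConfig x)).symm f) =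
      (permUnitary (shiftConfig (d := d) (y + x))).symm f := by
    ext ρ
    simp only [permUnitary_symm_apply]
    refine congrArg (fun ρ' => f ρ') (funext fun z => ?_)
    simp [shiftConfig, sub_sub, add_comm]
  rw [h]
  simp only [permUnitary_apply]
  refine congrArg (fun ρ => (A : SpinSpace d μ →L[ℂ] SpinSpace d μ) _ ρ) (funext fun z => ?_)
  simp [shiftConfig, add_assoc]

theorem translation_zero (A : SpinAlgebra d μ) : translation 0 A = A := by
  refine Subtype.ext ?_
  change shiftConj 0 (A : SpinSpace d μ →L[ℂ] SpinSpace d μ) = A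
  ext f σ
  change permUnitary (shiftConfig 0) ((A : SpinSpace d μ →L[ℂ] _)
    ((permUnitary (shiftConfig 0)).symm f)) σ = _
  have h : (permUnitary (shiftConfig (d := d) (0 : Site μ))).symm f = f := by
    ext ρ
    rw [permUnitary_symm_apply]
    refine congrArg (fun ρ' => f ρ') (funext fun z => ?_)
    simp [shiftConfig]
  rw [h, permUnitary_apply]
  refine congrArg (fun ρ => (A : SpinSpace d μ →L[ℂ] SpinSpace d μ) f ρ) (funext fun z => ?_)
  simp [shiftConfig]

theorem norm_translation_le (x : Site μ) (A : SpinAlgebra d μ) : ‖translation x A‖ ≤ ‖A‖ :=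
  NonUnitalStarAlgHom.norm_apply_le (translation x) A

/-! ### Space averages -/

theorem spaceAverage_add (Λ : Finset (Site μ)) (A B : SpinAlgebra d μ) :
    spaceAverage Λ (A + B) = spaceAverage Λ A + spaceAverage Λ B := by
  simp [spaceAverage, Finset.sum_add_distrib]

theorem spaceAverage_sub (Λ : Finset (Site μ)) (A B : SpinAlgebra d μ) :
    spaceAverage Λ (A - B) = spaceAverage Λ A - spaceAverage Λ B := by
  simp [spaceAverage, Finset.sum_sub_distrib, smul_sub]

theorem spaceAverage_smul (Λ : Finset (Site μ)) (c : ℂ) (A : SpinAlgebra d μ) :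
    spaceAverage Λ (c • A) = c • spaceAverage Λ A := by
  simp only [spaceAverage, map_smul, ← Finset.smul_sum]
  rw [smul_comm]

theorem norm_inv_card_smul_sum_le {F : Type*} [NormedAddCommGroup F] [NormedSpace ℂ F]
    (Λ : Finset (Site μ)) (v : Site μ → F) {C : ℝ} (hC : 0 ≤ C) (hv : ∀ x ∈ Λ, ‖v x‖ ≤ C) :
    ‖((Λ.card : ℂ)⁻¹) • ∑ x ∈ Λ, v x‖ ≤ C := by
  rcases Λ.eq_empty_or_nonempty with rfl | hΛ
  · simpa using hC
  have hpos : (0 : ℝ) < Λ.card := by exact_mod_cast hΛ.card_pos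
  rw [norm_smul, norm_inv, Complex.norm_natCast, inv_mul_le_iff₀ hpos]
  calc ‖∑ x ∈ Λ, v x‖ ≤ ∑ x ∈ Λ, ‖v x‖ := norm_sum_le _ _
    _ ≤ ∑ x ∈ Λ, C := Finset.sum_le_sum hv
    _ = Λ.card * C := by simp

theorem norm_spaceAverage_le (Λ : Finset (Site μ)) (A : SpinAlgebra d μ) :
    ‖spaceAverage Λ A‖ ≤ ‖A‖ :=
  norm_inv_card_smul_sum_le Λ _ (norm_nonneg A) fun x _ => norm_translation_le x A

/-! ### Van Hove limits -/

theorem vanHove_le_atTop : vanHove μ ≤ atTop := inf_le_left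

theorem tendsto_boundaryFraction (m : ℕ) : Tendsto (boundaryFraction (μ := μ) m) (vanHove μ) (𝓝 0) :=
  tendsto_comap.mono_left (inf_le_right.trans (iInf_le _ m))

theorem boundaryFraction_nonneg (m : ℕ) (Λ : Finset (Site μ)) : 0 ≤ boundaryFraction m Λ := by
  unfold boundaryFraction
  positivity

/-- The box `box x m` as a finite set. -/
noncomputable def finBox (x : Site μ) (m : ℕ) : Finset (Site μ) := Finset.Icc (fun k => x k - m) (fun k => x k + m)

theorem mem_finBox {x y : Site μ} {m : ℕ} : y ∈ finBox x m ↔ y ∈ box x m := by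
  simp only [finBox, Finset.mem_Icc, Pi.le_def, box, Set.mem_ofPred_eq, abs_le, ← forall_and]
  refine forall_congr' fun k => ?_
  constructor <;> rintro ⟨h1, h2⟩ <;> constructor <;> linarith

theorem coe_finBox (x : Site μ) (m : ℕ) : (finBox x m : Set (Site μ)) = box x m :=
  Set.ext fun _ => mem_finBox

theorem card_finBox (x : Site μ) (m : ℕ) : (finBox x m).card = (2 * m + 1) ^ μ := by
  have h (k : Fin μ) : (x k + m + 1 - (x k - m)).toNat = 2 * m + 1 := by omega
  simp [finBox, Pi.card_Icc, h]

theorem box_subset_box {x y : Site μ} {m n : ℕ} (hy : y ∈ box x n) : box y m ⊆ box x (n + m) := by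
  intro z hz k
  have h1 := abs_le.1 (hz k)
  have h2 := abs_le.1 (hy k)
  rw [abs_le]
  push_cast
  constructor <;> linarith

theorem box_mono (x : Site μ) {m n : ℕ} (h : m ≤ n) : box x m ⊆ box x n := by
  intro z hz k
  exact (hz k).trans (by exact_mod_cast h)

theorem mem_box_comm {x y : Site μ} {m : ℕ} : x ∈ box y m ↔ y ∈ box x m :=
  forall_congr' fun k => by rw [abs_sub_comm]

theorem exists_subset_box (S : Finset (Site μ)) : ∃ m : ℕ, (S : Set (Site μ)) ⊆ box 0 m := by
  classical
  induction S using Finset.induction_on with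
  | empty => exact ⟨0, by simp⟩
  | insert y S _ ih =>
    obtain ⟨m, hm⟩ := ih
    refine ⟨m + ∑ k, (y k).natAbs, ?_⟩
    rw [Finset.coe_insert, Set.insert_subset_iff]
    refine ⟨fun k => ?_, hm.trans (box_mono 0 (Nat.le_add_right _ _))⟩
    have : (y k).natAbs ≤ ∑ k, (y k).natAbs :=
      Finset.single_le_sum (f := fun k => (y k).natAbs) (fun _ _ => Nat.zero_le _)
        (Finset.mem_univ k)
    rw [Pi.zero_apply, sub_zero, ← Int.natCast_natAbs]
    omega

theorem tendsto_finBox_atTop : Tendsto (fun n : ℕ => finBox (0 : Site μ) n) atTop atTop := by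
  refine tendsto_atTop.2 fun S => ?_
  obtain ⟨m, hm⟩ := exists_subset_box S
  filter_upwards [eventually_ge_atTop m] with n hn
  rw [← Finset.coe_subset, coe_finBox]
  exact hm.trans (box_mono 0 hn)

/-- A site of the cube of radius `n` whose `m`-box leaves that cube lies outside the concentric cube
of radius `n - m`. -/
theorem boundaryFraction_finBox_le {m n : ℕ} (hmn : m ≤ n) :
    boundaryFraction m (finBox (0 : Site μ) n) ≤
      1 - ((2 * ((n : ℝ) - m) + 1) / (2 * n + 1)) ^ μ := by
  have hsub : {x : Site μ | x ∈ finBox 0 n ∧ ¬ box x m ⊆ (finBox (0 : Site μ) n : Set (Site μ))} ⊆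
      ((finBox 0 n \ finBox 0 (n - m) : Finset (Site μ)) : Set (Site μ)) := by
    rintro x ⟨hx, hx'⟩
    rw [Finset.coe_sdiff]
    refine ⟨hx, fun h => hx' ?_⟩
    rw [coe_finBox] at h ⊢
    have := box_subset_box (m := m) h
    rwa [Nat.sub_add_cancel hmn] at this
  have hsub' : finBox (0 : Site μ) (n - m) ⊆ finBox 0 n := by
    rw [← Finset.coe_subset, coe_finBox, coe_finBox]
    exact box_mono 0 (Nat.sub_le n m)
  have hcard := Set.ncard_le_ncard hsub (Finset.finite_toSet _)
  rw [Set.ncard_coe_finset, Finset.card_sdiff_of_subset hsub'] at hcard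
  have hcard' : (Set.ncard {x : Site μ | x ∈ finBox 0 n ∧
      ¬ box x m ⊆ (finBox (0 : Site μ) n : Set (Site μ))} : ℝ) ≤
      (2 * (n : ℝ) + 1) ^ μ - (2 * ((n : ℝ) - m) + 1) ^ μ := by
    have h := (Nat.cast_le (α := ℝ)).2 hcard
    rw [Nat.cast_sub (Finset.card_le_card hsub'), card_finBox, card_finBox] at h
    push_cast [Nat.cast_sub hmn] at h
    exact h
  have hpos : (0 : ℝ) < (2 * n + 1) ^ μ := by positivity
  rw [boundaryFraction, card_finBox, div_pow]
  push_cast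
  rw [div_le_iff₀ hpos, sub_mul, div_mul_cancel₀ _ hpos.ne', one_mul]
  exact hcard'

/-- Growing cubes show that `vanHove` is a proper filter, without which cluster points could not
exist. -/
theorem tendsto_finBox_vanHove : Tendsto (fun n : ℕ => finBox (0 : Site μ) n) atTop (vanHove μ) := by
  refine tendsto_inf.2 ⟨tendsto_finBox_atTop, tendsto_iInf.2 fun m => tendsto_comap_iff.2 ?_⟩
  have h0 : Tendsto (fun n : ℕ => (2 * m : ℝ) * (1 / (2 * (n : ℝ) + 1))) atTop (𝓝 (2 * m * 0)) := by
    refine Tendsto.const_mul _ ?_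
    refine squeeze_zero (fun n => by positivity) (fun n => ?_) tendsto_one_div_add_atTop_nhds_zero_nat
    exact one_div_le_one_div_of_le (by positivity) (by linarith [(n.cast_nonneg : (0 : ℝ) ≤ n)])
  have h1 : Tendsto (fun n : ℕ => 1 - (1 - (2 * m : ℝ) * (1 / (2 * (n : ℝ) + 1))) ^ μ) atTop
      (𝓝 0) := by
    have := (((h0.const_sub 1).pow μ).const_sub 1)
    simpa using this
  refine squeeze_zero' (Eventually.of_forall fun n => boundaryFraction_nonneg _ _) ?_ h1
  filter_upwards [eventually_ge_atTop m] with n hn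
  refine (boundaryFraction_finBox_le hn).trans_eq ?_
  have : (0 : ℝ) < 2 * n + 1 := by positivity
  congr 2
  field_simp
  ring

instance vanHove_neBot : (vanHove μ).NeBot := tendsto_finBox_vanHove.neBot

/-- In dimension `0` the lattice is a single point, hence the hypothesis on `μ`. -/
theorem tendsto_card_vanHove (hμ : 1 ≤ μ) :
    Tendsto (fun Λ : Finset (Site μ) => (Λ.card : ℝ)) (vanHove μ) atTop := by
  have : Nonempty (Fin μ) := ⟨⟨0, hμ⟩⟩
  refine tendsto_natCast_atTop_atTop.comp (Tendsto.mono_left ?_ vanHove_le_atTop)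
  refine tendsto_atTop.2 fun n => ?_
  obtain ⟨S, hS⟩ := Infinite.exists_subset_card_eq (Site μ) n
  filter_upwards [eventually_ge_atTop S] with Λ hΛ
  exact hS ▸ Finset.card_le_card hΛ

theorem tendsto_zero_of_approx {ι F : Type*} [NormedAddCommGroup F] {l : Filter ι} {f : ι → F}
    (h : ∀ ε > 0, ∃ g : ι → ℝ, Tendsto g l (𝓝 0) ∧ ∀ i, ‖f i‖ ≤ ε + g i) : Tendsto f l (𝓝 0) := by
  rw [tendsto_zero_iff_norm_tendsto_zero, Metric.tendsto_nhds]
  intro ε hε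
  obtain ⟨g, hg, hfg⟩ := h (ε / 2) (half_pos hε)
  filter_upwards [hg.eventually_lt_const (half_pos hε)] with i hi
  rw [Real.dist_eq, sub_zero, abs_norm]
  linarith [hfg i]

/-! ### Asymptotic behaviour of the space averages -/

/-- The two sums run over `Λ` and over its shift by `z`, so only the symmetric difference
contributes. Shifting back by `z` embeds one half of it into the sites whose `m`-box leaves `Λ`; the
other half has the same cardinality. -/
theorem norm_spaceAverage_translation_sub_le (Λ : Finset (Site μ)) {z : Site μ} {m : ℕ}
    (hz : z ∈ box 0 m) (A : SpinAlgebra d μ) :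
    ‖spaceAverage Λ (translation z A) - spaceAverage Λ A‖ ≤ 2 * ‖A‖ * boundaryFraction m Λ := by
  classical
  set Λ' : Finset (Site μ) := Λ.map (addLeftEmbedding z)
  have hsum : ∑ x ∈ Λ, translation x (translation z A) = ∑ x ∈ Λ', translation x A := by
    simp [Λ', translation_translation]
  have hcard : (Λ' \ Λ).card = (Λ \ Λ').card := Finset.card_sdiff_comm (by simp [Λ'])
  have hfin : {x : Site μ | x ∈ Λ ∧ ¬ box x m ⊆ (Λ : Set (Site μ))}.Finite :=
    Λ.finite_toSet.subset fun x hx => hx.1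
  have hbd : ((Λ' \ Λ).card : ℝ) ≤
      (Set.ncard {x : Site μ | x ∈ Λ ∧ ¬ box x m ⊆ (Λ : Set (Site μ))} : ℝ) := by
    rw [← Set.ncard_coe_finset]
    refine Nat.cast_le.2 (Set.ncard_le_ncard_of_injOn (fun y => y - z) ?_ ?_ hfin)
    · intro y hy
      obtain ⟨hy1, hy2⟩ := Finset.mem_sdiff.1 hy
      obtain ⟨x, hx, rfl⟩ := Finset.mem_map.1 hy1
      simp only [addLeftEmbedding_apply, add_sub_cancel_left] at hy2 ⊢
      refine ⟨hx, fun hsub => hy2 (hsub fun k => ?_)⟩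
      simpa using hz k
    · intro y _ y' _ hyy'
      simpa using hyy'
  rw [spaceAverage, spaceAverage, hsum, ← smul_sub, ← Finset.sum_sdiff_sub_sum_sdiff, norm_smul,
    norm_inv, Complex.norm_natCast]
  have h1 (T : Finset (Site μ)) : ‖∑ x ∈ T, translation x A‖ ≤ T.card * ‖A‖ := by
    refine (norm_sum_le_of_le T fun x _ => norm_translation_le x A).trans ?_
    simp
  have h2 : ‖∑ x ∈ Λ' \ Λ, translation x A - ∑ x ∈ Λ \ Λ', translation x A‖ ≤
      2 * ‖A‖ * (Λ' \ Λ).card := by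
    refine (norm_sub_le _ _).trans ?_
    have h3 := h1 (Λ' \ Λ)
    have h4 := h1 (Λ \ Λ')
    rw [← hcard] at h4
    linarith
  calc (Λ.card : ℝ)⁻¹ * ‖∑ x ∈ Λ' \ Λ, translation x A - ∑ x ∈ Λ \ Λ', translation x A‖
      ≤ (Λ.card : ℝ)⁻¹ * (2 * ‖A‖ *
        (Set.ncard {x : Site μ | x ∈ Λ ∧ ¬ box x m ⊆ (Λ : Set (Site μ))} : ℝ)) := by
        gcongr
        exact h2.trans (by gcongr)
    _ = 2 * ‖A‖ * boundaryFraction m Λ := by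
        rw [boundaryFraction]
        ring

theorem tendsto_spaceAverage_translation_sub (z : Site μ) (A : SpinAlgebra d μ) :
    Tendsto (fun Λ => spaceAverage Λ (translation z A) - spaceAverage Λ A) (vanHove μ) (𝓝 0) := by
  obtain ⟨m, hm⟩ := exists_subset_box {z}
  refine squeeze_zero_norm (fun Λ => norm_spaceAverage_translation_sub_le Λ (hm (by simp)) A) ?_
  simpa using (tendsto_boundaryFraction m).const_mul (2 * ‖A‖)

theorem norm_mul_sub_mul_le {𝔸 : Type*} [NormedRing 𝔸] (a b : 𝔸) :
    ‖a * b - b * a‖ ≤ 2 * ‖a‖ * ‖b‖ := by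
  refine (norm_sub_le _ _).trans ?_
  linarith [norm_mul_le a b, norm_mul_le b a, mul_comm ‖a‖ ‖b‖]

theorem tendsto_commutator_spaceAverage_of_isLocal (hμ : 1 ≤ μ) {A C : SpinAlgebra d μ}
    (hA : IsLocal A) (hC : IsLocal C) :
    Tendsto (fun Λ => spaceAverage Λ A * C - C * spaceAverage Λ A) (vanHove μ) (𝓝 0) := by
  classical
  obtain ⟨S, hS⟩ := hA
  obtain ⟨T, hT⟩ := hC
  -- Outside this finite set of differences the supports of `translation x A` and `C` are disjoint.
  -- The number of nonzero commutators is thus bounded independently of `Λ`, while the prefactor is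
  -- `1/|Λ|`.
  set U : Finset (Site μ) := Finset.image₂ (fun t s => t - s) T S
  have hU : ∀ x ∉ U, translation x A * C - C * translation x A = 0 := by
    intro x hx
    have h1 : IsLocalIn ((· + x) '' (S : Set (Site μ))) (translation x A) :=
      IsLocalIn.translation hS x
    have h2 : IsLocalIn (T : Set (Site μ)) C := hT
    refine sub_eq_zero.2 (IsLocalIn.commute ?_ h1 h2).eq
    rw [Set.disjoint_left]
    rintro _ ⟨s, hs, rfl⟩ ht
    exact hx (Finset.mem_image₂.2 ⟨s + x, ht, s, hs, by simp⟩)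
  have hbound (Λ : Finset (Site μ)) : ‖spaceAverage Λ A * C - C * spaceAverage Λ A‖ ≤
      (Λ.card : ℝ)⁻¹ * (U.card * (2 * ‖A‖ * ‖C‖)) := by
    rw [spaceAverage, smul_mul_assoc, mul_smul_comm, ← smul_sub, Finset.sum_mul, Finset.mul_sum,
      ← Finset.sum_sub_distrib, norm_smul, norm_inv, Complex.norm_natCast]
    gcongr
    rw [← Finset.sum_filter_of_ne (p := fun x => x ∈ U)
      (fun x _ hne => by_contra fun hx => hne (hU x hx))]
    refine (norm_sum_le_of_le _ (f := fun x => translation x A * C - C * translation x A)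
      (n := fun _ => 2 * ‖A‖ * ‖C‖) fun x _ => ?_).trans ?_
    · refine (norm_mul_sub_mul_le _ _).trans ?_
      gcongr
      exact norm_translation_le x A
    · rw [Finset.sum_const, nsmul_eq_mul]
      gcongr
      intro x hx
      exact (Finset.mem_filter.1 hx).2
  refine squeeze_zero_norm hbound ?_
  simpa using ((tendsto_card_vanHove hμ).inv_tendsto_atTop).mul_const (U.card * (2 * ‖A‖ * ‖C‖))

theorem tendsto_commutator_spaceAverage (hμ : 1 ≤ μ) (A C : SpinAlgebra d μ) :
    Tendsto (fun Λ => spaceAverage Λ A * C - C * spaceAverage Λ A) (vanHove μ) (𝓝 0) := by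
  have key : ∀ A C : SpinAlgebra d μ, IsLocal C →
      Tendsto (fun Λ => spaceAverage Λ A * C - C * spaceAverage Λ A) (vanHove μ) (𝓝 0) := by
    intro A C hC
    refine tendsto_zero_of_approx fun ε hε => ?_
    -- The summand `1` keeps the denominator positive when `C = 0`.
    have hpos : 0 < 2 * ‖C‖ + 1 := by positivity
    obtain ⟨A', hA', hAA'⟩ := exists_isLocal_norm_sub_le A (div_pos hε hpos)
    refine ⟨_, (tendsto_commutator_spaceAverage_of_isLocal hμ hA' hC).norm.trans_eq
      (congrArg 𝓝 norm_zero), fun Λ => ?_⟩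
    have hdec : spaceAverage Λ A * C - C * spaceAverage Λ A =
        (spaceAverage Λ (A - A') * C - C * spaceAverage Λ (A - A')) +
        (spaceAverage Λ A' * C - C * spaceAverage Λ A') := by
      rw [spaceAverage_sub]
      noncomm_ring
    rw [hdec]
    refine (norm_add_le _ _).trans (add_le_add_left ?_ _)
    calc _ ≤ 2 * ‖spaceAverage Λ (A - A')‖ * ‖C‖ := norm_mul_sub_mul_le _ _
      _ ≤ 2 * (ε / (2 * ‖C‖ + 1)) * ‖C‖ := by
          gcongr
          exact (norm_spaceAverage_le _ _).trans hAA'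
      _ ≤ ε := by
          rw [mul_div_assoc', div_mul_eq_mul_div, div_le_iff₀ hpos]
          linarith
  refine tendsto_zero_of_approx fun ε hε => ?_
  have hpos : 0 < 2 * ‖A‖ + 1 := by positivity
  obtain ⟨C', hC', hCC'⟩ := exists_isLocal_norm_sub_le C (div_pos hε hpos)
  refine ⟨_, (key A C' hC').norm.trans_eq (congrArg 𝓝 norm_zero), fun Λ => ?_⟩
  have hdec : spaceAverage Λ A * C - C * spaceAverage Λ A =
      (spaceAverage Λ A * (C - C') - (C - C') * spaceAverage Λ A) +
      (spaceAverage Λ A * C' - C' * spaceAverage Λ A) := by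
    noncomm_ring
  rw [hdec]
  refine (norm_add_le _ _).trans (add_le_add_left ?_ _)
  calc _ ≤ 2 * ‖spaceAverage Λ A‖ * ‖C - C'‖ := norm_mul_sub_mul_le _ _
    _ ≤ 2 * ‖A‖ * (ε / (2 * ‖A‖ + 1)) := by
        gcongr
        exact norm_spaceAverage_le _ _
    _ ≤ ε := by
        rw [mul_div_assoc', div_le_iff₀ hpos]
        linarith

/-! ### Mean ergodic theorem -/

section Ergodic

variable {W : Type*} [NormedAddCommGroup W] [InnerProductSpace ℂ W]

/-- The smallest set that contains the translates of `B` and is stable under midpoints and space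
averages. -/
inductive IsTranslationMean (B : SpinAlgebra d μ) : SpinAlgebra d μ → Prop
  | of_translation (z : Site μ) : IsTranslationMean B (translation z B)
  | midpoint {C C' : SpinAlgebra d μ} (hC : IsTranslationMean B C) (hC' : IsTranslationMean B C') :
      IsTranslationMean B ((1 / 2 : ℂ) • (C + C'))
  | average {Λ : Finset (Site μ)} (hΛ : Λ.Nonempty) {C : SpinAlgebra d μ}
      (hC : IsTranslationMean B C) : IsTranslationMean B (spaceAverage Λ C)

theorem spaceAverage_sum {ι : Type*} (Λ : Finset (Site μ)) (s : Finset ι)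
    (F : ι → SpinAlgebra d μ) : spaceAverage Λ (∑ i ∈ s, F i) = ∑ i ∈ s, spaceAverage Λ (F i) := by
  simp only [spaceAverage, map_sum]
  rw [Finset.sum_comm, Finset.smul_sum]

/-- A translation changes the average over a large region only by a boundary term, and midpoints and
finite averages are convex combinations, which preserve this. -/
theorem IsTranslationMean.tendsto_spaceAverage_sub {B C : SpinAlgebra d μ}
    (hC : IsTranslationMean B C) :
    Tendsto (fun Λ => spaceAverage Λ C - spaceAverage Λ B) (vanHove μ) (𝓝 0) := by
  induction hC with
  | of_translation z => exact tendsto_spaceAverage_translation_sub z B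
  | @midpoint C C' _ _ h h' =>
    have h1 := (h.add h').const_smul (1 / 2 : ℂ)
    rw [add_zero, smul_zero] at h1
    refine h1.congr fun Λ => ?_
    rw [spaceAverage_smul, spaceAverage_add]
    module
  | @average Λ₀ hΛ₀ C _ h =>
    have h1 : Tendsto (fun Λ => ((Λ₀.card : ℂ)⁻¹) •
        ∑ z ∈ Λ₀, (spaceAverage Λ (translation z C) - spaceAverage Λ C)) (vanHove μ) (𝓝 0) := by
      have h2 := (tendsto_finsetSum Λ₀ fun z _ =>
        tendsto_spaceAverage_translation_sub z C).const_smul ((Λ₀.card : ℂ)⁻¹)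
      rwa [Finset.sum_const_zero, smul_zero] at h2
    have h3 := h1.add h
    rw [add_zero] at h3
    refine h3.congr fun Λ => ?_
    have hcard : (Λ₀.card : ℂ) ≠ 0 := by exact_mod_cast hΛ₀.card_pos.ne'
    rw [spaceAverage.eq_1 Λ₀ C, spaceAverage_smul, spaceAverage_sum, Finset.sum_sub_distrib,
      Finset.sum_const, smul_sub, ← Nat.cast_smul_eq_nsmul ℂ, inv_smul_smul₀ hcard]
    abel

theorem map_spaceAverage (V : SpinAlgebra d μ →ₗ[ℂ] W) (Λ : Finset (Site μ)) (A : SpinAlgebra d μ) :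
    V (spaceAverage Λ A) = ((Λ.card : ℂ)⁻¹) • ∑ x ∈ Λ, V (translation x A) := by
  simp [spaceAverage]

/-- The convexity proof of the mean ergodic theorem: elements of almost minimal norm in a convex set
are close to each other, by the parallelogram law. A mean `C` of translates of `B` is chosen with
`‖V C‖` almost minimal. Averaging does not increase the norm, so all averages of `C` are almost
minimal too, and they asymptotically agree with the averages of `B`. No completeness of `W` is
needed. -/
theorem cauchy_map_spaceAverage (V : SpinAlgebra d μ →ₗ[ℂ] W)
    (hV : ∀ z A, ‖V (translation z A)‖ = ‖V A‖) {K : ℝ} (hK : ∀ A, ‖V A‖ ≤ K * ‖A‖)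
    (B : SpinAlgebra d μ) {ε : ℝ} (hε : 0 < ε) :
    ∃ s ∈ vanHove μ, ∀ Λ ∈ s, ∀ Λ' ∈ s, ‖V (spaceAverage Λ B) - V (spaceAverage Λ' B)‖ < ε := by
  set S : Set (SpinAlgebra d μ) := {C | IsTranslationMean B C}
  set D : ℝ := sInf ((fun A => ‖V A‖ ^ 2) '' S)
  have hbdd : BddBelow ((fun A => ‖V A‖ ^ 2) '' S) := ⟨0, by rintro _ ⟨A, -, rfl⟩; positivity⟩
  have hD (A) (hA : A ∈ S) : D ≤ ‖V A‖ ^ 2 := csInf_le hbdd ⟨A, hA, rfl⟩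
  have hne : ((fun A => ‖V A‖ ^ 2) '' S).Nonempty :=
    ⟨_, translation 0 B, IsTranslationMean.of_translation 0, rfl⟩
  -- If both squared norms are below `D + η` and that of the midpoint is at least `D`, the
  -- parallelogram law bounds the squared distance by `4 * η = (ε / 3) ^ 2`.
  set η : ℝ := (ε / 3) ^ 2 / 4
  have hη : 0 < η := by positivity
  obtain ⟨_, ⟨C, hCS, rfl⟩, hC⟩ := exists_lt_of_csInf_lt hne (lt_add_of_pos_right D hη)
  have hav (Λ : Finset (Site μ)) : ‖V (spaceAverage Λ C)‖ ≤ ‖V C‖ := by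
    rw [map_spaceAverage]
    exact norm_inv_card_smul_sum_le Λ _ (norm_nonneg _) fun x _ => (hV x C).le
  have hav2 (Λ : Finset (Site μ)) : ‖V (spaceAverage Λ C)‖ ^ 2 < D + η :=
    (pow_le_pow_left₀ (norm_nonneg _) (hav Λ) 2).trans_lt hC
  have hdiff (Λ Λ' : Finset (Site μ)) (hΛ : Λ.Nonempty) (hΛ' : Λ'.Nonempty) :
      ‖V (spaceAverage Λ C) - V (spaceAverage Λ' C)‖ ≤ ε / 3 := by
    set X := spaceAverage Λ C
    set Y := spaceAverage Λ' C
    have hX : X ∈ S := IsTranslationMean.average hΛ hCS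
    have hY : Y ∈ S := IsTranslationMean.average hΛ' hCS
    have h1 := hD _ (IsTranslationMean.midpoint hX hY)
    rw [map_smul, map_add, norm_smul, mul_pow] at h1
    have h3 := parallelogram_law_with_norm ℂ (V X) (V Y)
    have h4 := hav2 Λ
    have h5 := hav2 Λ'
    have h6 : ‖V X - V Y‖ ^ 2 ≤ (ε / 3) ^ 2 := by
      norm_num at h1
      have : (ε / 3) ^ 2 = 4 * η := by simp only [η]; ring
      rw [this]
      nlinarith
    exact (sq_le_sq₀ (norm_nonneg _) (by positivity)).1 h6
  have hlim : Tendsto (fun Λ => K * ‖spaceAverage Λ C - spaceAverage Λ B‖) (vanHove μ) (𝓝 0) := by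
    simpa using (IsTranslationMean.tendsto_spaceAverage_sub hCS).norm.const_mul K
  -- The average over the empty set is `0`, which need not be a mean of translates.
  refine ⟨{Λ | Λ.Nonempty ∧ K * ‖spaceAverage Λ C - spaceAverage Λ B‖ < ε / 3}, ?_, ?_⟩
  · refine Filter.inter_mem ?_ (hlim.eventually_lt_const (by positivity))
    refine vanHove_le_atTop ?_
    filter_upwards [eventually_ge_atTop {0}] with Λ hΛ
    exact ⟨0, hΛ (by simp)⟩
  · rintro Λ ⟨hΛ, hΛε⟩ Λ' ⟨hΛ', hΛε'⟩
    have h1 := hdiff Λ Λ' hΛ hΛ'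
    have h2 := (hK (spaceAverage Λ C - spaceAverage Λ B)).trans_lt hΛε
    have h3 := (hK (spaceAverage Λ' C - spaceAverage Λ' B)).trans_lt hΛε'
    rw [map_sub] at h2 h3
    have h4 : V (spaceAverage Λ B) - V (spaceAverage Λ' B) =
        (V (spaceAverage Λ C) - V (spaceAverage Λ' C)) -
        (V (spaceAverage Λ C) - V (spaceAverage Λ B)) +
        (V (spaceAverage Λ' C) - V (spaceAverage Λ' B)) := by abel
    rw [h4]
    have h5 := norm_add_le ((V (spaceAverage Λ C) - V (spaceAverage Λ' C)) -
        (V (spaceAverage Λ C) - V (spaceAverage Λ B)))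
        (V (spaceAverage Λ' C) - V (spaceAverage Λ' B))
    have h6 := norm_sub_le (V (spaceAverage Λ C) - V (spaceAverage Λ' C))
        (V (spaceAverage Λ C) - V (spaceAverage Λ B))
    linarith

end Ergodic

/-! ### Macroscopic observables -/

section GNS

variable {E : Type*} [NormedAddCommGroup E] [InnerProductSpace ℂ E] [CompleteSpace E]

theorem norm_starAlgHom_le (π : SpinAlgebra d μ →⋆ₐ[ℂ] (E →L[ℂ] E)) (A : SpinAlgebra d μ) :
    ‖π A‖ ≤ ‖A‖ := NonUnitalStarAlgHom.norm_apply_le π A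

theorem norm_apply_vector_le (π : SpinAlgebra d μ →⋆ₐ[ℂ] (E →L[ℂ] E)) (A : SpinAlgebra d μ) (v : E) :
    ‖π A v‖ ≤ ‖A‖ * ‖v‖ :=
  ((π A).le_opNorm v).trans (by gcongr; exact norm_starAlgHom_le π A)

variable {φ : SpinAlgebra d μ →ₗ[ℂ] ℂ} {π : SpinAlgebra d μ →⋆ₐ[ℂ] (E →L[ℂ] E)} {Ω : E}

theorem IsGNSTriple.norm_sq (hGNS : IsGNSTriple φ π Ω) (A : SpinAlgebra d μ) :
    ‖π A Ω‖ ^ 2 = (φ (star A * A)).re := by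
  rw [hGNS.vector_state, map_mul, map_star, mul_apply_eq_comp,
    ContinuousLinearMap.star_eq_adjoint, ContinuousLinearMap.adjoint_inner_right,
    inner_self_eq_norm_sq_to_K]
  norm_cast

/-- Since `φ` is invariant only under `Δ`, the seminorm `‖π A Ω‖` need not be translation invariant.
Collecting the vectors `π (translation c A) Ω` over coset representatives `c` repairs this: a
translation permutes the finitely many cosets, and by invariance the norms do not depend on the
representatives. -/
theorem cauchy_map_spaceAverage_vector (hhom : IsHomogeneous φ) (hGNS : IsGNSTriple φ π Ω)
    (A : SpinAlgebra d μ) {ε : ℝ} (hε : 0 < ε) :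
    ∃ s ∈ vanHove μ, ∀ Λ ∈ s, ∀ Λ' ∈ s,
      ‖π (spaceAverage Λ A) Ω - π (spaceAverage Λ' A) Ω‖ < ε := by
  classical
  obtain ⟨Δ, hΔ, hinv⟩ := hhom
  have : Fintype (Site μ ⧸ Δ) := AddSubgroup.fintypeQuotientOfFiniteIndex
  set F : SpinAlgebra d μ → Site μ → ℝ := fun A x => ‖π (translation x A) Ω‖ ^ 2
  have hF (A : SpinAlgebra d μ) (x y : Site μ) (hxy : (x : Site μ ⧸ Δ) = y) : F A x = F A y := by
    have hδ : -x + y ∈ Δ := QuotientAddGroup.eq.1 hxy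
    have hy : translation y A = translation (-x + y) (translation x A) := by
      rw [translation_translation]
      simp
    simp only [F, hGNS.norm_sq]
    have h := hinv _ hδ (star (translation x A) * translation x A)
    rw [map_mul, map_star] at h
    rw [hy, h]
  set V : SpinAlgebra d μ →ₗ[ℂ] PiLp 2 (fun _ : Site μ ⧸ Δ => E) :=
    (WithLp.linearEquiv 2 ℂ (Site μ ⧸ Δ → E)).symm.toLinearMap ∘ₗ
      LinearMap.pi fun c =>
        { toFun := fun A => π (translation c.out A) Ω
          map_add' := fun A B => by simp
          map_smul' := fun a A => by simp }
  have hVsq (A : SpinAlgebra d μ) : ‖V A‖ ^ 2 = ∑ c : Site μ ⧸ Δ, F A c.out := by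
    rw [PiLp.norm_sq_eq_of_L2]
    rfl
  have hV (z : Site μ) (A : SpinAlgebra d μ) : ‖V (translation z A)‖ = ‖V A‖ := by
    refine (sq_eq_sq₀ (norm_nonneg _) (norm_nonneg _)).1 ?_
    rw [hVsq, hVsq, ← Equiv.sum_comp (Equiv.addLeft (z : Site μ ⧸ Δ)) fun c => F A c.out]
    refine Finset.sum_congr rfl fun c _ => ?_
    have h1 : F (translation z A) c.out = F A (z + c.out) := by
      simp only [F, translation_translation]
    rw [h1]
    refine hF A _ _ ?_
    simp
  have hle (A : SpinAlgebra d μ) : ‖π A Ω‖ ≤ ‖V A‖ := by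
    refine (sq_le_sq₀ (norm_nonneg _) (norm_nonneg _)).1 ?_
    rw [hVsq]
    have h1 : ‖π A Ω‖ ^ 2 = F A (((0 : Site μ) : Site μ ⧸ Δ).out) := by
      rw [← hF A 0 _ (by simp)]
      simp only [F, translation_zero]
    rw [h1]
    exact Finset.single_le_sum (f := fun c : Site μ ⧸ Δ => F A c.out)
      (fun c _ => by positivity) (Finset.mem_univ _)
  have hK (A : SpinAlgebra d μ) :
      ‖V A‖ ≤ Real.sqrt (Fintype.card (Site μ ⧸ Δ)) * ‖Ω‖ * ‖A‖ := by
    refine (sq_le_sq₀ (norm_nonneg _) (by positivity)).1 ?_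
    rw [hVsq, mul_assoc, mul_pow, Real.sq_sqrt (by positivity)]
    calc ∑ c : Site μ ⧸ Δ, F A c.out ≤ ∑ c : Site μ ⧸ Δ, (‖Ω‖ * ‖A‖) ^ 2 := by
          refine Finset.sum_le_sum fun c _ => ?_
          refine pow_le_pow_left₀ (norm_nonneg _) ?_ 2
          rw [mul_comm]
          exact (norm_apply_vector_le π _ Ω).trans (by gcongr; exact norm_translation_le _ A)
      _ = _ := by simp
  obtain ⟨s, hs, h⟩ := cauchy_map_spaceAverage V hV hK A hε
  refine ⟨s, hs, fun Λ hΛ Λ' hΛ' => ?_⟩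
  have h1 := h Λ hΛ Λ' hΛ'
  rw [← map_sub] at h1
  have h2 := hle (spaceAverage Λ A - spaceAverage Λ' A)
  rw [map_sub, sub_apply] at h2
  exact h2.trans_lt h1

theorem cauchy_map_of_forall {ι F : Type*} [NormedAddCommGroup F] {l : Filter ι} [l.NeBot]
    {f : ι → F}
    (h : ∀ ε > 0, ∃ s ∈ l, ∀ i ∈ s, ∀ j ∈ s, ‖f i - f j‖ < ε) : Cauchy (map f l) := by
  refine Metric.cauchy_iff.2 ⟨inferInstance, fun ε hε => ?_⟩
  obtain ⟨s, hs, hs'⟩ := h ε hε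
  refine ⟨f '' s, image_mem_map hs, ?_⟩
  rintro _ ⟨i, hi, rfl⟩ _ ⟨j, hj, rfl⟩
  rw [dist_eq_norm]
  exact hs' i hi j hj

/-- Up to a vanishing commutator, `C` can be moved to the left of the average, which then acts on
`Ω`. -/
theorem exists_tendsto_spaceAverage_cyclic (hμ : 1 ≤ μ) (hhom : IsHomogeneous φ)
    (hGNS : IsGNSTriple φ π Ω) (A C : SpinAlgebra d μ) :
    ∃ w, Tendsto (fun Λ => π (spaceAverage Λ A) (π C Ω)) (vanHove μ) (𝓝 w) := by
  obtain ⟨w, hw⟩ := cauchy_map_iff_exists_tendsto.1 (cauchy_map_of_forall fun ε hε =>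
    cauchy_map_spaceAverage_vector hhom hGNS A hε)
  have h1 : Tendsto (fun Λ => π (spaceAverage Λ A * C - C * spaceAverage Λ A) Ω)
      (vanHove μ) (𝓝 0) := by
    refine squeeze_zero_norm (fun Λ => norm_apply_vector_le π _ Ω) ?_
    simpa using (tendsto_commutator_spaceAverage hμ A C).norm.mul_const ‖Ω‖
  refine ⟨π C w + 0, ((((π C).continuous.tendsto w).comp hw).add h1).congr fun Λ => ?_⟩
  simp

theorem exists_tendsto_spaceAverage (hμ : 1 ≤ μ) (hhom : IsHomogeneous φ)
    (hGNS : IsGNSTriple φ π Ω) (A : SpinAlgebra d μ) :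
    ∃ a : E →L[ℂ] E, ∀ v, Tendsto (fun Λ => π (spaceAverage Λ A) v) (vanHove μ) (𝓝 (a v)) := by
  have hnorm (Λ : Finset (Site μ)) (v : E) : ‖π (spaceAverage Λ A) v‖ ≤ ‖A‖ * ‖v‖ :=
    (norm_apply_vector_le π _ v).trans (by gcongr; exact norm_spaceAverage_le Λ A)
  have hex (v : E) : ∃ w, Tendsto (fun Λ => π (spaceAverage Λ A) v) (vanHove μ) (𝓝 w) := by
    refine cauchy_map_iff_exists_tendsto.1 (cauchy_map_of_forall fun ε hε => ?_)
    have hpos : 0 < 3 * (‖A‖ + 1) := by positivity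
    obtain ⟨_, hC, C, rfl⟩ :=
      -- The radius makes each of the two errors from replacing `v` by `π C Ω` at most `ε / 3`; the
      -- Cauchy estimate on `π C Ω` supplies the last third.
      Metric.dense_iff.1 hGNS.cyclic v (ε / (3 * (‖A‖ + 1))) (by positivity)
    obtain ⟨w, hw⟩ := exists_tendsto_spaceAverage_cyclic hμ hhom hGNS A C
    obtain ⟨s, hs, hs'⟩ := (Metric.cauchy_iff.1 hw.cauchy_map).2 (ε / 3) (by positivity)
    refine ⟨_, hs, fun Λ hΛ Λ' hΛ' => ?_⟩
    have h1 := hs' _ hΛ _ hΛ'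
    have h2 : ‖A‖ * ‖v - π C Ω‖ ≤ ε / 3 := by
      rw [Metric.mem_ball, dist_comm, dist_eq_norm, lt_div_iff₀ hpos] at hC
      nlinarith [norm_nonneg (v - π C Ω)]
    have h3 := (hnorm Λ (v - π C Ω)).trans h2
    have h4 := (hnorm Λ' (v - π C Ω)).trans h2
    rw [dist_eq_norm] at h1
    have h5 : π (spaceAverage Λ A) v - π (spaceAverage Λ' A) v =
        (π (spaceAverage Λ A) (π C Ω) - π (spaceAverage Λ' A) (π C Ω)) +
        π (spaceAverage Λ A) (v - π C Ω) - π (spaceAverage Λ' A) (v - π C Ω) := by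
      rw [map_sub, map_sub]
      abel
    rw [h5]
    have h6 := norm_sub_le ((π (spaceAverage Λ A) (π C Ω) - π (spaceAverage Λ' A) (π C Ω)) +
        π (spaceAverage Λ A) (v - π C Ω)) (π (spaceAverage Λ' A) (v - π C Ω))
    have h7 := norm_add_le (π (spaceAverage Λ A) (π C Ω) - π (spaceAverage Λ' A) (π C Ω))
        (π (spaceAverage Λ A) (v - π C Ω))
    linarith
  choose a ha using hex
  refine ⟨ContinuousLinearMap.ofTendstoOfBoundedRange a (fun Λ => π (spaceAverage Λ A))
    (tendsto_pi_nhds.2 ha) ?_, ha⟩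
  refine (Metric.isBounded_closedBall (x := (0 : E →L[ℂ] E)) (r := ‖A‖)).subset ?_
  rintro _ ⟨Λ, rfl⟩
  rw [mem_closedBall_zero_iff]
  exact (norm_starAlgHom_le π _).trans (norm_spaceAverage_le Λ A)

/-- Strong convergence implies weak convergence, and in the Hausdorff weak operator topology a
convergent family has its limit as only cluster point. -/
theorem isDensity_iff_of_tendsto {A : SpinAlgebra d μ} {a : E →L[ℂ] E}
    (ha : ∀ v, Tendsto (fun Λ => π (spaceAverage Λ A) v) (vanHove μ) (𝓝 (a v)))
    {b : E →L[ℂ] E} : IsDensity π A b ↔ b = a := by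
  have hlim : Tendsto (fun Λ => (ContinuousLinearMapWOT.ofCLM (π (spaceAverage Λ A)) : E →WOT[ℂ] E))
      (vanHove μ) (𝓝 (ContinuousLinearMapWOT.ofCLM a)) := by
    refine ContinuousLinearMapWOT.tendsto_iff_forall_inner_apply_tendsto.2 fun v w => ?_
    exact tendsto_const_nhds.inner (ha v)
  constructor
  · intro hb
    exact ContinuousLinearMapWOT.ofCLM_injective (eq_of_nhds_neBot (ClusterPt.mono hb hlim))
  · rintro rfl
    exact hlim.mapClusterPt

end GNS

/-! ### Local dynamics -/

section Commutator

variable {𝔸 : Type*} [NormedRing 𝔸] [NormedAlgebra ℂ 𝔸]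

/-- The commutator `A ↦ H A - A H` as a bounded operator. -/
noncomputable def adCLM (H : 𝔸) : 𝔸 →L[ℂ] 𝔸 :=
  ContinuousLinearMap.mul ℂ 𝔸 H - (ContinuousLinearMap.mul ℂ 𝔸).flip H

theorem adCLM_apply (H A : 𝔸) : adCLM H A = H * A - A * H := rfl

theorem adCLM_smul (c : ℂ) (H : 𝔸) : adCLM (c • H) = c • adCLM H := by
  ext A
  simp [adCLM_apply, smul_sub]

theorem exp_mul_apply [CompleteSpace 𝔸] (H A : 𝔸) :
    NormedSpace.exp (ContinuousLinearMap.mul ℂ 𝔸 H) A = NormedSpace.exp H * A := by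
  have h1 := (NormedSpace.exp_series_hasSum_exp' (𝕂 := ℂ) (ContinuousLinearMap.mul ℂ 𝔸 H)).mapL
    (ContinuousLinearMap.apply ℂ 𝔸 A)
  have h2 := (NormedSpace.exp_series_hasSum_exp' (𝕂 := ℂ) H).mul_right A
  refine h1.unique (h2.congr_fun fun n => ?_)
  have hpow : ((ContinuousLinearMap.mul ℂ 𝔸 H) ^ n) A = H ^ n * A := by
    induction n with
    | zero => simp
    | succ n ih => simp [pow_succ', ih, mul_assoc]
  simp [hpow]

theorem exp_flip_mul_apply [CompleteSpace 𝔸] (H A : 𝔸) :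
    NormedSpace.exp ((ContinuousLinearMap.mul ℂ 𝔸).flip H) A = A * NormedSpace.exp H := by
  have h1 := (NormedSpace.exp_series_hasSum_exp' (𝕂 := ℂ)
    ((ContinuousLinearMap.mul ℂ 𝔸).flip H)).mapL (ContinuousLinearMap.apply ℂ 𝔸 A)
  have h2 := (NormedSpace.exp_series_hasSum_exp' (𝕂 := ℂ) H).mul_left A
  refine h1.unique (h2.congr_fun fun n => ?_)
  have hpow : (((ContinuousLinearMap.mul ℂ 𝔸).flip H) ^ n) A = A * H ^ n := by
    induction n with
    | zero => simp
    | succ n ih =>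
      rw [pow_succ', mul_apply_eq_comp, ih]
      simp [mul_assoc, pow_succ]
  simp [hpow]

/-- The `n`-fold commutator `A ↦ [H, [H, … [H, A]]]`. -/
noncomputable def iteratedAd (H : 𝔸) (n : ℕ) : 𝔸 →L[ℂ] 𝔸 := adCLM H ^ n

theorem iteratedAd_zero (H A : 𝔸) : iteratedAd H 0 A = A := rfl

theorem iteratedAd_succ (H A : 𝔸) (n : ℕ) :
    iteratedAd H (n + 1) A = iteratedAd H n (adCLM H A) := by
  rw [iteratedAd, pow_succ]
  rfl

theorem iteratedAd_succ' (H A : 𝔸) (n : ℕ) :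
    iteratedAd H (n + 1) A = adCLM H (iteratedAd H n A) := by
  rw [iteratedAd, pow_succ']
  rfl

theorem iteratedAd_smul (c : ℂ) (H A : 𝔸) (n : ℕ) :
    iteratedAd (c • H) n A = c ^ n • iteratedAd H n A := by
  induction n with
  | zero => simp [iteratedAd_zero]
  | succ n ih =>
    rw [iteratedAd_succ', iteratedAd_succ', ih, adCLM_smul, smul_apply, map_smul, smul_smul,
      pow_succ']

/-- Left and right multiplications commute, so the exponential of their difference `adCLM H` factors
into the two one-sided exponentials. -/
theorem hasSum_exp_mul_mul_exp_neg [CompleteSpace 𝔸] (H A : 𝔸) :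
    HasSum (fun n : ℕ => ((n.factorial : ℂ)⁻¹) • (adCLM H ^ n) A)
      (NormedSpace.exp H * A * NormedSpace.exp (-H)) := by
  let +nondep : NormedAlgebra ℚ (𝔸 →L[ℂ] 𝔸) := .restrictScalars ℚ ℂ _
  have h1 := (NormedSpace.exp_series_hasSum_exp' (𝕂 := ℂ) (adCLM H)).mapL
    (ContinuousLinearMap.apply ℂ 𝔸 A)
  have hcomm : Commute (ContinuousLinearMap.mul ℂ 𝔸 H) ((ContinuousLinearMap.mul ℂ 𝔸).flip (-H)) := by
    ext B
    simp [mul_assoc]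
  have h2 : adCLM H = ContinuousLinearMap.mul ℂ 𝔸 H + (ContinuousLinearMap.mul ℂ 𝔸).flip (-H) := by
    ext B
    simp [adCLM_apply, sub_eq_add_neg]
  have h3 : NormedSpace.exp (adCLM H) A = NormedSpace.exp H * A * NormedSpace.exp (-H) := by
    rw [h2, NormedSpace.exp_add_of_commute hcomm, mul_apply_eq_comp, exp_mul_apply,
      exp_flip_mul_apply, mul_assoc]
  rw [← h3]
  exact h1

theorem hasSum_exp_smul_mul_mul_exp_neg_smul [CompleteSpace 𝔸] (c : ℂ) (H A : 𝔸) :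
    HasSum (fun n : ℕ => ((n.factorial : ℂ)⁻¹ * c ^ n) • iteratedAd H n A)
      (NormedSpace.exp (c • H) * A * NormedSpace.exp (-c • H)) := by
  rw [neg_smul]
  refine (hasSum_exp_mul_mul_exp_neg (c • H) A).congr_fun fun n => ?_
  rw [mul_smul, ← iteratedAd_smul, iteratedAd]

end Commutator

theorem hasSum_localEvolution (h : Site μ → SpinAlgebra d μ) (Λ : Finset (Site μ)) (t : ℝ)
    (A : SpinAlgebra d μ) :
    HasSum (fun n : ℕ => ((n.factorial : ℂ)⁻¹ * (Complex.I * t) ^ n) •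
      iteratedAd (localHamiltonian h Λ) n A) (localEvolution h Λ t A) :=
  hasSum_exp_smul_mul_mul_exp_neg_smul _ _ A

section LocalEvolution

variable (h : Site μ → SpinAlgebra d μ) (Λ : Finset (Site μ))

theorem localEvolution_add_apply (s t : ℝ) (A : SpinAlgebra d μ) :
    localEvolution h Λ (s + t) A = localEvolution h Λ s (localEvolution h Λ t A) := by
  let +nondep : NormedAlgebra ℚ (SpinAlgebra d μ) := .restrictScalars ℚ ℂ _
  have hc (a b : ℂ) : Commute (a • localHamiltonian h Λ) (b • localHamiltonian h Λ) :=
    ((Commute.refl _).smul_left a).smul_right b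
  have h1 : (Complex.I * ((s + t : ℝ) : ℂ)) • localHamiltonian h Λ =
      (Complex.I * (s : ℂ)) • localHamiltonian h Λ +
        (Complex.I * (t : ℂ)) • localHamiltonian h Λ := by
    rw [← add_smul]
    congr 1
    push_cast
    ring
  have h2 : (-(Complex.I * ((s + t : ℝ) : ℂ))) • localHamiltonian h Λ =
      (-(Complex.I * (t : ℂ))) • localHamiltonian h Λ +
        (-(Complex.I * (s : ℂ))) • localHamiltonian h Λ := by
    rw [← add_smul]
    congr 1
    push_cast
    ring
  simp only [localEvolution]
  rw [h1, h2, NormedSpace.exp_add_of_commute (hc _ _), NormedSpace.exp_add_of_commute (hc _ _)]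
  simp only [mul_assoc]

theorem localEvolution_sub (t : ℝ) (A B : SpinAlgebra d μ) :
    localEvolution h Λ t (A - B) = localEvolution h Λ t A - localEvolution h Λ t B := by
  simp [localEvolution, mul_sub, sub_mul]

theorem localEvolution_smul (t : ℝ) (c : ℂ) (A : SpinAlgebra d μ) :
    localEvolution h Λ t (c • A) = c • localEvolution h Λ t A := by
  simp [localEvolution]

theorem localEvolution_sum {ι : Type*} (s : Finset ι) (t : ℝ) (F : ι → SpinAlgebra d μ) :
    localEvolution h Λ t (∑ i ∈ s, F i) = ∑ i ∈ s, localEvolution h Λ t (F i) := by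
  simp [localEvolution, Finset.mul_sum, Finset.sum_mul]

variable {h} in
theorem norm_localEvolution_le (hh : ∀ x, IsSelfAdjoint (h x)) (t : ℝ) (A : SpinAlgebra d μ) :
    ‖localEvolution h Λ t A‖ ≤ ‖A‖ := by
  have hH : IsSelfAdjoint (localHamiltonian h Λ) := by
    rw [localHamiltonian, IsSelfAdjoint, star_sum]
    exact Finset.sum_congr rfl fun x _ => hh x
  have hu (s : ℝ) : NormedSpace.exp ((Complex.I * (s : ℂ)) • localHamiltonian h Λ) ∈
      unitary (SpinAlgebra d μ) := by
    have hs : IsSelfAdjoint ((s : ℂ) • localHamiltonian h Λ) :=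
      IsSelfAdjoint.smul (Complex.conj_ofReal s) hH
    have := (selfAdjoint.expUnitary ⟨_, hs⟩).2
    rwa [selfAdjoint.expUnitary_coe, smul_smul] at this
  have h1 := hu t
  have h2 := hu (-t)
  rw [Complex.ofReal_neg, mul_neg] at h2
  rw [localEvolution, CStarRing.norm_mul_mem_unitary _ h2, CStarRing.norm_mem_unitary_mul _ h1]

end LocalEvolution

/-! ### Uniformly local families -/

/-- A family `(A_x)` of elements that are uniformly localized around `x` and uniformly bounded. -/
def IsUniformlyLocal (A : Site μ → SpinAlgebra d μ) : Prop :=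
  ∃ (r : ℕ) (M : ℝ), ∀ x, IsLocalIn (box x r) (A x) ∧ ‖A x‖ ≤ M

/-- The families `(F_{Λ,x})` which do not depend on `Λ ⊇ box x m` and are uniformly local. -/
def IsEventuallyUniformlyLocal (F : Finset (Site μ) → Site μ → SpinAlgebra d μ) : Prop :=
  ∃ A, IsUniformlyLocal A ∧ ∃ m : ℕ, ∀ x (Λ : Finset (Site μ)),
    box x m ⊆ (Λ : Set (Site μ)) → F Λ x = A x

namespace IsEventuallyUniformlyLocal

theorem zero : IsEventuallyUniformlyLocal (d := d) (μ := μ) fun _ _ => 0 :=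
  ⟨fun _ => 0, ⟨0, 0, fun x => ⟨zero_mem (localAlgebra d _), by simp⟩⟩, 0, fun _ _ _ => rfl⟩

variable {F G : Finset (Site μ) → Site μ → SpinAlgebra d μ}

theorem add (hF : IsEventuallyUniformlyLocal F) (hG : IsEventuallyUniformlyLocal G) :
    IsEventuallyUniformlyLocal fun Λ x => F Λ x + G Λ x := by
  obtain ⟨A, ⟨r, M, hA⟩, m, hm⟩ := hF
  obtain ⟨B, ⟨r', M', hB⟩, m', hm'⟩ := hG
  refine ⟨fun x => A x + B x, ⟨max r r', M + M', fun x => ⟨?_, ?_⟩⟩, max m m', fun x Λ hΛ => ?_⟩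
  · exact ((hA x).1.mono (box_mono x (le_max_left _ _))).add
      ((hB x).1.mono (box_mono x (le_max_right _ _)))
  · exact (norm_add_le _ _).trans (add_le_add (hA x).2 (hB x).2)
  · simp only [hm x Λ ((box_mono x (le_max_left _ _)).trans hΛ),
      hm' x Λ ((box_mono x (le_max_right _ _)).trans hΛ)]

theorem smul (hF : IsEventuallyUniformlyLocal F) (c : ℂ) :
    IsEventuallyUniformlyLocal fun Λ x => c • F Λ x := by
  obtain ⟨A, ⟨r, M, hA⟩, m, hm⟩ := hF
  refine ⟨fun x => c • A x, ⟨r, ‖c‖ * M, fun x => ⟨(hA x).1.smul c, ?_⟩⟩, m, fun x Λ hΛ => ?_⟩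
  · rw [norm_smul]
    gcongr
    exact (hA x).2
  · simp only [hm x Λ hΛ]

theorem sum_range {F : ℕ → Finset (Site μ) → Site μ → SpinAlgebra d μ}
    (hF : ∀ n, IsEventuallyUniformlyLocal (F n)) (k : ℕ) :
    IsEventuallyUniformlyLocal fun Λ x => ∑ n ∈ Finset.range k, F n Λ x := by
  induction k with
  | zero => simpa using zero
  | succ k ih =>
    simp only [Finset.sum_range_succ]
    exact ih.add (hF k)

end IsEventuallyUniformlyLocal

/-! ### Iterated commutators with a finite-range Hamiltonian: localization and growth. -/

section Interaction

variable {h : Site μ → SpinAlgebra d μ} {R : ℕ} {N : ℝ}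

theorem adCLM_localHamiltonian (Λ : Finset (Site μ)) (A : SpinAlgebra d μ) :
    adCLM (localHamiltonian h Λ) A = ∑ y ∈ Λ, (h y * A - A * h y) := by
  rw [adCLM_apply, localHamiltonian, Finset.sum_mul, Finset.mul_sum, Finset.sum_sub_distrib]

theorem commutator_eq_zero (hR : ∀ x, IsLocalIn (box x R) (h x)) {S : Set (Site μ)}
    {A : SpinAlgebra d μ} (hA : IsLocalIn S A) {y : Site μ} (hy : Disjoint (box y R) S) :
    h y * A - A * h y = 0 :=
  sub_eq_zero.2 ((hR y).commute hy hA).eq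

theorem norm_commutator_le (hN : ∀ x, ‖h x‖ ≤ N) (A : SpinAlgebra d μ) (y : Site μ) :
    ‖h y * A - A * h y‖ ≤ 2 * N * ‖A‖ :=
  (norm_mul_sub_mul_le _ _).trans (by gcongr; exact hN y)

/-- Only the `h y` with `y` within distance `r + R` of `x` fail to commute with `A x`; once `Λ`
contains these sites, enlarging it changes nothing. Their supports reach a further distance `R`. -/
theorem isEventuallyUniformlyLocal_adCLM (hR : ∀ x, IsLocalIn (box x R) (h x))
    (hN : ∀ x, ‖h x‖ ≤ N) {F : Finset (Site μ) → Site μ → SpinAlgebra d μ}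
    (hF : IsEventuallyUniformlyLocal F) :
    IsEventuallyUniformlyLocal fun Λ x => adCLM (localHamiltonian h Λ) (F Λ x) := by
  obtain ⟨A, ⟨r, M, hA⟩, m, hm⟩ := hF
  have hN0 : 0 ≤ N := (norm_nonneg _).trans (hN 0)
  refine ⟨fun x => ∑ y ∈ finBox x (r + R), (h y * A x - A x * h y),
    ⟨r + R + R, (2 * (r + R) + 1) ^ μ * (2 * N * M), fun x => ⟨?_, ?_⟩⟩,
    max m (r + R), fun x Λ hΛ => ?_⟩
  · refine IsLocalIn.sum fun y hy => ?_
    have h1 : IsLocalIn (box x (r + R + R)) (h y) := (hR y).mono (box_subset_box (mem_finBox.1 hy))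
    have h2 : IsLocalIn (box x (r + R + R)) (A x) :=
      (hA x).1.mono (box_mono x (by omega))
    exact (h1.mul h2).sub (h2.mul h1)
  · refine (norm_sum_le_of_le _ (n := fun _ => 2 * N * M) fun y _ => ?_).trans ?_
    · exact (norm_commutator_le hN (A x) y).trans (by gcongr; exact (hA x).2)
    · rw [Finset.sum_const, card_finBox, nsmul_eq_mul]
      push_cast
      rfl
  · beta_reduce
    rw [hm x Λ ((box_mono x (le_max_left _ _)).trans hΛ), adCLM_localHamiltonian]
    have hsub : finBox x (r + R) ⊆ Λ := by
      rw [← Finset.coe_subset, coe_finBox]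
      exact (box_mono x (le_max_right _ _)).trans hΛ
    refine (Finset.sum_subset hsub fun y _ hy => commutator_eq_zero hR (hA x).1 ?_).symm
    rw [Set.disjoint_left]
    intro z hz hz'
    exact hy (mem_finBox.2 (box_subset_box hz' (mem_box_comm.1 hz)))

theorem isEventuallyUniformlyLocal_iteratedAd (hR : ∀ x, IsLocalIn (box x R) (h x))
    (hN : ∀ x, ‖h x‖ ≤ N) {A : Site μ → SpinAlgebra d μ} (hA : IsUniformlyLocal A) (n : ℕ) :
    IsEventuallyUniformlyLocal fun Λ x => iteratedAd (localHamiltonian h Λ) n (A x) := by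
  induction n with
  | zero => exact ⟨A, hA, 0, fun _ _ _ => rfl⟩
  | succ n ih =>
    simp only [iteratedAd_succ']
    exact isEventuallyUniformlyLocal_adCLM hR hN ih

/-- With `c = (2 * R + 1) ^ μ`, an element supported on at most `c * (s + 1)` sites meets at most `c
* c * (s + 1)` terms `h y`, each costing a factor `2 * N` and adding at most `c` sites to the
support. One commutator thus costs `2 * N * c ^ 2 * (s + 1)` and raises `s` by one, whence the
rising factorial. The size of `Λ` never enters. -/
theorem norm_iteratedAd_le_ascFactorial (hR : ∀ x, IsLocalIn (box x R) (h x)) (hN : ∀ x, ‖h x‖ ≤ N)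
    (Λ : Finset (Site μ)) (n : ℕ) : ∀ (s : ℕ) (S : Finset (Site μ)) (A : SpinAlgebra d μ),
      S.card ≤ (2 * R + 1) ^ μ * (s + 1) → IsLocalIn (S : Set (Site μ)) A →
      ‖iteratedAd (localHamiltonian h Λ) n A‖ ≤
        (2 * N * ((2 * R + 1) ^ μ) ^ 2) ^ n * (s + 1).ascFactorial n * ‖A‖ := by
  classical
  have hN0 : 0 ≤ N := (norm_nonneg _).trans (hN 0)
  set c : ℕ := (2 * R + 1) ^ μ with hc
  have hcR : ((2 * R + 1 : ℝ) ^ μ) = c := by rw [hc]; push_cast; rfl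
  rw [hcR]
  induction n with
  | zero => intro s S A _ _; simp [iteratedAd_zero]
  | succ n ih =>
    intro s S A hS hA
    set U : Finset (Site μ) := S.biUnion fun x => finBox x R
    have hU (y : Site μ) (hy : y ∉ U) : h y * A - A * h y = 0 := by
      refine commutator_eq_zero hR hA ?_
      rw [Set.disjoint_left]
      intro z hz hz'
      exact hy (Finset.mem_biUnion.2 ⟨z, hz', mem_finBox.2 (mem_box_comm.1 hz)⟩)
    have hUcard : U.card ≤ c * (c * (s + 1)) := by
      refine (Finset.card_biUnion_le_card_mul S _ c fun x _ => (card_finBox x R).le).trans ?_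
      rw [mul_comm]
      exact Nat.mul_le_mul_left c hS
    have hterm (y : Site μ) : ‖iteratedAd (localHamiltonian h Λ) n (h y * A - A * h y)‖ ≤
        (2 * N * c ^ 2) ^ n * (s + 2).ascFactorial n * (2 * N * ‖A‖) := by
      refine (ih (s + 1) (S ∪ finBox y R) _ ?_ ?_).trans ?_
      · refine (Finset.card_union_le _ _).trans ?_
        rw [card_finBox]
        linarith
      · have h1 : IsLocalIn ((S ∪ finBox y R : Finset (Site μ)) : Set (Site μ)) (h y) :=
          (hR y).mono (by rw [Finset.coe_union, coe_finBox]; exact Set.subset_union_right)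
        have h2 : IsLocalIn ((S ∪ finBox y R : Finset (Site μ)) : Set (Site μ)) A :=
          hA.mono (by rw [Finset.coe_union]; exact Set.subset_union_left)
        exact (h1.mul h2).sub (h2.mul h1)
      · gcongr
        exact norm_commutator_le hN A y
    -- The innermost commutator is split off, so that the induction hypothesis applies to local
    -- elements on slightly larger supports.
    rw [iteratedAd_succ, adCLM_localHamiltonian, map_sum,
      ← Finset.sum_filter_of_ne (p := fun y => y ∈ U)
        (fun y _ hne => by_contra fun hy => hne (by rw [hU y hy, map_zero]))]
    refine (norm_sum_le_of_le _ fun y _ => hterm y).trans ?_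
    rw [Finset.sum_const, nsmul_eq_mul]
    have hcard : ((Λ.filter fun y => y ∈ U).card : ℝ) ≤ c * (c * (s + 1)) := by
      have : (Λ.filter fun y => y ∈ U).card ≤ c * (c * (s + 1)) :=
        (Finset.card_le_card fun y hy => (Finset.mem_filter.1 hy).2).trans hUcard
      exact_mod_cast this
    have hasc : ((s + 1).ascFactorial (n + 1) : ℝ) = (s + 1) * (s + 2).ascFactorial n := by
      have := Nat.succ_ascFactorial (s + 1) n
      rw [← Nat.ascFactorial_succ] at this
      exact_mod_cast this.symm
    calc _ ≤ (c * (c * (s + 1)) : ℝ) *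
          ((2 * N * c ^ 2) ^ n * (s + 2).ascFactorial n * (2 * N * ‖A‖)) := by gcongr
      _ = _ := by rw [hasc]; ring

/-- The rising factorial is `n!` times a binomial coefficient, which is at most `2 ^ (S.card + n)`.
The `n!` cancels against the exponential series, leaving a geometric series for small times. -/
theorem norm_iteratedAd_le (hR : ∀ x, IsLocalIn (box x R) (h x)) (hN : ∀ x, ‖h x‖ ≤ N)
    (Λ : Finset (Site μ)) (n : ℕ) {S : Finset (Site μ)} {A : SpinAlgebra d μ}
    (hA : IsLocalIn (S : Set (Site μ)) A) :
    ‖iteratedAd (localHamiltonian h Λ) n A‖ ≤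
      n.factorial * (4 * N * ((2 * R + 1) ^ μ) ^ 2) ^ n * 2 ^ S.card * ‖A‖ := by
  have hN0 : 0 ≤ N := (norm_nonneg _).trans (hN 0)
  have hpos : 1 ≤ (2 * R + 1) ^ μ := Nat.one_le_pow _ _ (by omega)
  refine (norm_iteratedAd_le_ascFactorial hR hN Λ n S.card S A (by nlinarith) hA).trans ?_
  have h1 : ((S.card + 1).ascFactorial n : ℝ) ≤ n.factorial * 2 ^ (S.card + n) := by
    have : (S.card + 1).ascFactorial n ≤ n.factorial * 2 ^ (S.card + n) := by
      rw [Nat.ascFactorial_eq_factorial_mul_choose]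
      exact Nat.mul_le_mul_left _ (Nat.choose_le_two_pow _ _)
    exact_mod_cast this
  calc _ ≤ (2 * N * ((2 * R + 1) ^ μ) ^ 2) ^ n * (n.factorial * 2 ^ (S.card + n)) * ‖A‖ := by
        gcongr
    _ = _ := by
        rw [show 4 * N * ((2 * (R : ℝ) + 1) ^ μ) ^ 2 = (2 * N * ((2 * R + 1) ^ μ) ^ 2) * 2 by ring,
          mul_pow _ (2 : ℝ) n, pow_add]
        ring

end Interaction

/-! ### Approximation of the local evolutions by local elements, uniformly in space. -/

section UniformApproximation

variable {h : Site μ → SpinAlgebra d μ} {R : ℕ} {N : ℝ}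

/-- The local evolutions at time `t` map uniformly local families to families that are uniformly
approximated by uniformly local ones. -/
def HasUniformApproximation (h : Site μ → SpinAlgebra d μ) (t : ℝ) : Prop :=
  ∀ A, IsUniformlyLocal A → ∀ ε > 0, ∃ B, IsUniformlyLocal B ∧ ∃ m : ℕ, ∀ x (Λ : Finset (Site μ)),
    box x m ⊆ (Λ : Set (Site μ)) → ‖localEvolution h Λ t (A x) - B x‖ ≤ ε

/-- For such `t` the commutator series is dominated by a geometric series of ratio `1/2`, uniformly
in `x` and `Λ`. A truncation of fixed order therefore suffices, and truncations stop depending on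
`Λ` once it contains a large enough box around `x`. -/
theorem hasUniformApproximation_of_small (hR : ∀ x, IsLocalIn (box x R) (h x))
    (hN : ∀ x, ‖h x‖ ≤ N) {t : ℝ} (ht : |t| * (4 * N * ((2 * R + 1) ^ μ) ^ 2) ≤ 1 / 2) :
    HasUniformApproximation h t := by
  intro A hA ε hε
  obtain ⟨r, M, hrM⟩ := id hA
  have hN0 : 0 ≤ N := (norm_nonneg _).trans (hN 0)
  have hM0 : 0 ≤ M := (norm_nonneg _).trans (hrM 0).2
  set κ : ℝ := 4 * N * ((2 * R + 1) ^ μ) ^ 2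
  have hκ : 0 ≤ κ := by positivity
  set C : ℝ := 2 ^ ((2 * r + 1) ^ μ) * M
  have hterm (Λ : Finset (Site μ)) (x : Site μ) (n : ℕ) :
      ‖((n.factorial : ℂ)⁻¹ * (Complex.I * t) ^ n) • iteratedAd (localHamiltonian h Λ) n (A x)‖ ≤
        C * (1 / 2) ^ n := by
    have hloc : IsLocalIn (finBox x r : Set (Site μ)) (A x) := by
      rw [coe_finBox]
      exact (hrM x).1
    have h1 := norm_iteratedAd_le hR hN Λ n hloc
    rw [card_finBox] at h1
    have hfac : (0 : ℝ) < n.factorial := by exact_mod_cast n.factorial_pos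
    rw [norm_smul, norm_mul, norm_inv, norm_pow, norm_mul, Complex.norm_I, Complex.norm_natCast,
      Complex.norm_real, Real.norm_eq_abs, one_mul]
    calc _ ≤ ((n.factorial : ℝ)⁻¹ * |t| ^ n) *
          (n.factorial * κ ^ n * 2 ^ ((2 * r + 1) ^ μ) * M) := by
          gcongr
          refine h1.trans ?_
          gcongr
          exact (hrM x).2
      _ = C * (|t| * κ) ^ n := by
          rw [mul_pow]
          simp only [C]
          linear_combination (|t| ^ n * κ ^ n * 2 ^ ((2 * r + 1) ^ μ) * M) *
            inv_mul_cancel₀ hfac.ne'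
      _ ≤ C * (1 / 2) ^ n := by gcongr
  obtain ⟨k, hk⟩ : ∃ k : ℕ, C * (1 / 2) ^ k / (1 - 1 / 2) ≤ ε := by
    have hlim : Tendsto (fun k : ℕ => C * (1 / 2 : ℝ) ^ k / (1 - 1 / 2)) atTop (𝓝 0) := by
      simpa using ((tendsto_pow_atTop_nhds_zero_of_lt_one (r := (1 / 2 : ℝ)) (by norm_num)
        (by norm_num)).const_mul C).div_const (1 - 1 / 2)
    exact (hlim.eventually_le_const hε).exists
  obtain ⟨B, hB, m, hm⟩ := IsEventuallyUniformlyLocal.sum_range (fun n =>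
    (isEventuallyUniformlyLocal_iteratedAd hR hN hA n).smul
      ((n.factorial : ℂ)⁻¹ * (Complex.I * t) ^ n)) k
  refine ⟨B, hB, m, fun x Λ hΛ => ?_⟩
  rw [← hm x Λ hΛ, norm_sub_rev]
  exact (norm_sub_le_of_geometric_bound_of_hasSum (by norm_num) (hterm Λ x)
    (hasSum_localEvolution h Λ t (A x)) k).trans hk

/-- The evolution for time `s` is a contraction, so it does not enlarge the error made at time `t`.
-/
theorem HasUniformApproximation.add (hh : ∀ x, IsSelfAdjoint (h x)) {s t : ℝ}
    (hs : HasUniformApproximation h s) (ht : HasUniformApproximation h t) :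
    HasUniformApproximation h (s + t) := by
  intro A hA ε hε
  obtain ⟨B, hB, m, hm⟩ := ht A hA (ε / 2) (half_pos hε)
  obtain ⟨C, hC, m', hm'⟩ := hs B hB (ε / 2) (half_pos hε)
  refine ⟨C, hC, max m m', fun x Λ hΛ => ?_⟩
  have h1 := hm x Λ ((box_mono x (le_max_left _ _)).trans hΛ)
  have h2 := hm' x Λ ((box_mono x (le_max_right _ _)).trans hΛ)
  have h3 := norm_localEvolution_le Λ hh s (localEvolution h Λ t (A x) - B x)
  rw [localEvolution_sub] at h3
  rw [localEvolution_add_apply,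
    ← sub_add_sub_cancel _ (localEvolution h Λ s (B x)) (C x)]
  refine (norm_add_le _ _).trans ?_
  linarith

theorem IsFiniteRange.hasUniformApproximation (hh : IsFiniteRange h) (t : ℝ) :
    HasUniformApproximation h t := by
  obtain ⟨R, hR⟩ := hh.range
  obtain ⟨N, hN⟩ := hh.bounded
  have hN0 : 0 ≤ N := (norm_nonneg _).trans (hN 0)
  set κ : ℝ := 4 * N * ((2 * R + 1) ^ μ) ^ 2
  have hκ : 0 ≤ κ := by positivity
  -- The admissible time step depends only on `N`, `R` and `μ`, so `t` is cut into `n + 1` equal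
  -- steps, each satisfying the smallness condition.
  obtain ⟨n, hn⟩ := exists_nat_ge (2 * (|t| * κ))
  have hpos : (0 : ℝ) < n + 1 := by positivity
  have hsmall : HasUniformApproximation h (t / (n + 1)) := by
    refine hasUniformApproximation_of_small hR hN ?_
    rw [abs_div, abs_of_pos hpos, div_mul_eq_mul_div, div_le_iff₀ hpos]
    change |t| * κ ≤ _
    linarith
  have hmul (k : ℕ) : HasUniformApproximation h ((k + 1) * (t / (n + 1))) := by
    induction k with
    | zero => simpa using hsmall
    | succ k ih =>
      have := hsmall.add hh.selfAdjoint ih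
      convert this using 1
      push_cast
      ring
  have := hmul n
  rwa [mul_div_cancel₀ _ hpos.ne'] at this

end UniformApproximation

/-! ### Comparison of the local and the infinite-volume dynamics on space averages. -/

theorem isUniformlyLocal_translation {A : SpinAlgebra d μ} (hA : IsLocal A) :
    IsUniformlyLocal fun x => translation x A := by
  obtain ⟨S, hS⟩ := hA
  obtain ⟨m, hm⟩ := exists_subset_box S
  have hS' : IsLocalIn (S : Set (Site μ)) A := hS
  refine ⟨m, ‖A‖, fun x => ⟨(hS'.translation x).mono ?_, norm_translation_le x A⟩⟩
  rintro _ ⟨y, hy, rfl⟩ k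
  simpa using hm hy k

/-- The local approximant `B x` serves as a reference point. It is within `ε / 2` of the local
evolution for every `Λ` containing the box around `x`, hence also of the limit, which is
`translation x (α t A)` by translation invariance of `α`. -/
theorem exists_norm_localEvolution_translation_sub_le {h : Site μ → SpinAlgebra d μ}
    (hh : IsFiniteRange h) {α : ℝ → (SpinAlgebra d μ ≃⋆ₐ[ℂ] SpinAlgebra d μ)}
    (hinv : IsTranslationInvariant α) (happ : IsApproximatelyInner h α) (t : ℝ)
    {A : SpinAlgebra d μ} (hA : IsLocal A) {ε : ℝ} (hε : 0 < ε) :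
    ∃ m : ℕ, ∀ x (Λ : Finset (Site μ)), box x m ⊆ (Λ : Set (Site μ)) →
      ‖localEvolution h Λ t (translation x A) - translation x (α t A)‖ ≤ ε := by
  obtain ⟨B, -, m, hm⟩ := hh.hasUniformApproximation t _ (isUniformlyLocal_translation hA)
    (ε / 2) (half_pos hε)
  refine ⟨m, fun x Λ hΛ => ?_⟩
  have h1 : ‖translation x (α t A) - B x‖ ≤ ε / 2 := by
    rw [← hinv]
    refine le_of_tendsto ((happ t (translation x A)).sub_const (B x)).norm ?_
    filter_upwards [eventually_ge_atTop (finBox x m)] with Λ' hΛ'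
    refine hm x Λ' ?_
    rw [← coe_finBox]
    exact_mod_cast hΛ'
  have h2 := hm x Λ hΛ
  rw [← sub_sub_sub_cancel_right _ _ (B x)]
  refine (norm_sub_le _ _).trans ?_
  linarith

/-- The bulk sites contribute at most `ε` and the boundary sites at most `C` times their fraction.
-/
theorem norm_inv_card_smul_sum_le_boundaryFraction {F : Type*} [NormedAddCommGroup F]
    [NormedSpace ℂ F] (Λ : Finset (Site μ)) (v : Site μ → F) (m : ℕ) {ε C : ℝ} (hε : 0 ≤ ε)
    (hv : ∀ x ∈ Λ, box x m ⊆ (Λ : Set (Site μ)) → ‖v x‖ ≤ ε) (hC : ∀ x, ‖v x‖ ≤ C) :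
    ‖((Λ.card : ℂ)⁻¹) • ∑ x ∈ Λ, v x‖ ≤ ε + C * boundaryFraction m Λ := by
  classical
  have hC0 : 0 ≤ C := (norm_nonneg _).trans (hC 0)
  rcases Λ.eq_empty_or_nonempty with rfl | hΛ
  · simpa [boundaryFraction] using hε
  have hpos : (0 : ℝ) < Λ.card := by exact_mod_cast hΛ.card_pos
  have hcard : Set.ncard {x : Site μ | x ∈ Λ ∧ ¬ box x m ⊆ (Λ : Set (Site μ))} =
      (Λ.filter fun x => ¬ box x m ⊆ (Λ : Set (Site μ))).card := by
    rw [← Set.ncard_coe_finset]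
    simp
  rw [boundaryFraction, hcard, norm_smul, norm_inv, Complex.norm_natCast, inv_mul_le_iff₀ hpos,
    ← Finset.sum_filter_add_sum_filter_not Λ fun x => box x m ⊆ (Λ : Set (Site μ))]
  have h1 : ‖∑ x ∈ Λ.filter fun x => box x m ⊆ (Λ : Set (Site μ)), v x‖ ≤ Λ.card * ε := by
    refine (norm_sum_le_of_le _ (n := fun _ => ε) fun x hx =>
      hv x (Finset.mem_filter.1 hx).1 (Finset.mem_filter.1 hx).2).trans ?_
    rw [Finset.sum_const, nsmul_eq_mul]
    gcongr
    exact Finset.filter_subset _ _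
  have h2 : ‖∑ x ∈ Λ.filter fun x => ¬ box x m ⊆ (Λ : Set (Site μ)), v x‖ ≤
      (Λ.filter fun x => ¬ box x m ⊆ (Λ : Set (Site μ))).card * C := by
    refine (norm_sum_le_of_le _ (n := fun _ => C) fun x _ => hC x).trans ?_
    rw [Finset.sum_const, nsmul_eq_mul]
  refine (norm_add_le _ _).trans ((add_le_add h1 h2).trans_eq ?_)
  field_simp

theorem tendsto_localEvolution_spaceAverage_sub {h : Site μ → SpinAlgebra d μ}
    (hh : IsFiniteRange h) {α : ℝ → (SpinAlgebra d μ ≃⋆ₐ[ℂ] SpinAlgebra d μ)}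
    (hinv : IsTranslationInvariant α) (happ : IsApproximatelyInner h α) (t : ℝ)
    {A : SpinAlgebra d μ} (hA : IsLocal A) :
    Tendsto (fun Λ => localEvolution h Λ t (spaceAverage Λ A) - spaceAverage Λ (α t A))
      (vanHove μ) (𝓝 0) := by
  refine tendsto_zero_of_approx fun ε hε => ?_
  obtain ⟨m, hm⟩ := exists_norm_localEvolution_translation_sub_le hh hinv happ t hA hε
  refine ⟨fun Λ => (‖A‖ + ‖α t A‖) * boundaryFraction m Λ, ?_, fun Λ => ?_⟩
  · simpa using (tendsto_boundaryFraction m).const_mul (‖A‖ + ‖α t A‖)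
  · rw [spaceAverage, spaceAverage, localEvolution_smul, localEvolution_sum, ← smul_sub,
      ← Finset.sum_sub_distrib]
    refine norm_inv_card_smul_sum_le_boundaryFraction Λ _ m hε.le (fun x _ hx => hm x Λ hx)
      fun x => (norm_sub_le _ _).trans (add_le_add ?_ (norm_translation_le x _))
    exact (norm_localEvolution_le Λ hh.selfAdjoint t _).trans (norm_translation_le x A)

/-! ### Temporal correlations -/

theorem mainTheorem5 {d μ : ℕ} (hd : 1 ≤ d) (hμ : 1 ≤ μ)
    (h : Site μ → SpinAlgebra d μ) (hh : IsFiniteRange h)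
    (α : ℝ → (SpinAlgebra d μ ≃⋆ₐ[ℂ] SpinAlgebra d μ)) (hα : IsCStarDynamics α)
    (hinv : IsTranslationInvariant α) (happ : IsApproximatelyInner h α)
    (β : ℝ) (hβ : 0 ≤ β)
    (A₀ B₀ : SpinAlgebra d μ) (hA : IsLocal A₀) (hB : IsLocal B₀)
    -- `φ` is a limiting Gibbs state: the limit of the local Gibbs states along `l₁`
    (l₁ : Filter (Finset (Site μ))) [l₁.NeBot] (hl₁ : l₁ ≤ Filter.atTop)
    (φ : SpinAlgebra d μ →ₗ[ℂ] ℂ) (hφ : IsState φ)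
    (hlim : ∀ A, Filter.Tendsto (fun Λ => gibbsState h β Λ A) l₁ (nhds (φ A)))
    (hhom : IsHomogeneous φ)
    {E : Type*} [NormedAddCommGroup E] [InnerProductSpace ℂ E] [CompleteSpace E]
    (π : SpinAlgebra d μ →⋆ₐ[ℂ] (E →L[ℂ] E)) (Ω : E) (hGNS : IsGNSTriple φ π Ω) :
    ∃ f : ℝ → ℂ, ∀ t : ℝ,
      temporalCorrelations π Ω α A₀ B₀ t = {f t} ∧
      ∃ g : Finset (Site μ) → ℂ,
        (∀ Λ₂, Filter.Tendsto
          (fun Λ₁ => gibbsState h β Λ₁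
            (localEvolution h Λ₂ t (spaceAverage Λ₂ A₀) * spaceAverage Λ₂ B₀)) l₁ (nhds (g Λ₂))) ∧
        Filter.Tendsto g (vanHove μ) (nhds (f t)) := by
  -- The strong limits are needed for all elements, since `α t A₀` is in general no longer local.
  choose a ha using exists_tendsto_spaceAverage hμ hhom hGNS
  refine ⟨fun t => inner ℂ Ω (a (α t A₀) (a B₀ Ω)), fun t => ⟨?_, _, fun Λ₂ => hlim _, ?_⟩⟩
  · ext z
    simp only [temporalCorrelations, isDensity_iff_of_tendsto (ha _), Set.mem_ofPred_eq,
      Set.mem_singleton_iff]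
    constructor
    · rintro ⟨_, _, rfl, rfl, rfl⟩
      rfl
    · rintro rfl
      exact ⟨_, _, rfl, rfl, rfl⟩
  -- The vector splits into three terms: the error of the dynamics, the error of replacing `π
  -- (spaceAverage Λ B₀) Ω` by its limit under uniformly bounded operators, and an average acting on
  -- the fixed vector `a B₀ Ω`.
  have hdiff : Tendsto (fun Λ => π (localEvolution h Λ t (spaceAverage Λ A₀) -
      spaceAverage Λ (α t A₀)) (π (spaceAverage Λ B₀) Ω)) (vanHove μ) (𝓝 0) := by
    refine squeeze_zero_norm (fun Λ => norm_apply_vector_le π _ _) ?_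
    simpa using (tendsto_localEvolution_spaceAverage_sub hh hinv happ t hA).norm.mul
      (ha B₀ Ω).norm
  have hB' : Tendsto (fun Λ => π (spaceAverage Λ (α t A₀)) (π (spaceAverage Λ B₀) Ω - a B₀ Ω))
      (vanHove μ) (𝓝 0) := by
    have h0 : Tendsto (fun Λ => ‖α t A₀‖ * ‖π (spaceAverage Λ B₀) Ω - a B₀ Ω‖) (vanHove μ)
        (𝓝 0) := by
      simpa using ((ha B₀ Ω).sub_const (a B₀ Ω)).norm.const_mul ‖α t A₀‖
    refine squeeze_zero_norm (fun Λ => (norm_apply_vector_le π _ _).trans ?_) h0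
    gcongr
    exact norm_spaceAverage_le _ _
  have hsum := (hdiff.add hB').add (ha (α t A₀) (a B₀ Ω))
  rw [add_zero, zero_add] at hsum
  refine (tendsto_const_nhds.inner hsum).congr fun Λ => ?_
  rw [hGNS.vector_state]
  simp only [map_sub, map_mul, sub_apply, mul_apply_eq_comp]
  congr 1
  abel
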